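/- **Setting.** Let $\Omega\subset\mathbb C$ be a bounded Borel set, $\lambda$ Lebesgue measure, $\mathcal C_1$ and $\mathcal C_2$ the trace class and the Hilbert--Schmidt class of $L^2(\Omega,\lambda)$, with norms $|T|_1=\operatorname{Tr}\,(T^*T)^{1/2}$ and $|T|_2=(\operatorname{Tr}\,T^*T)^{1/2}$ (each $=\infty$ off the class). For $f\in L^\infty(\Omega,\lambda)$ let $M_f$ be the operator of multiplication by $f$ on $L^2(\Omega,\lambda)$, let $Df(s,t)=\frac{f(s)-f(t)}{s-t}$ $(s\neq t)$, and let $\Lambda(\Omega)=\{f\in L^\infty(\Omega,\lambda): Df\in L^\infty(\Omega\times\Omega,\lambda\otimes\lambda)\}$. For a bounded operator $T$ on $L^2(\Omega,\lambda)$ put $$L(T)=\sup\{\,|[M_f,T]|_2 : f\in\Lambda(\Omega),\ \|Df\|_\infty\le 1\,\}.$$ Let $K\Lambda(\Omega)$ be the space of all compact operators $T$ on $L^2(\Omega,\lambda)$ with $L(T)<\infty$, with the norm $\|T\|+L(T)$, and let $Z$ be the operator of multiplication by the coordinate function $z$. Give $\mathcal C_1\times\mathcal C_2$ the norm $\max(|x|_1,|y|_2)$.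 **Proposition.** Let $$\mathcal N=\{([Z,H],H) : H\in\mathcal C_2,\ [Z,H]\in\mathcal C_1\}\subset \mathcal C_1\times\mathcal C_2 .$$ For all $T\in K\Lambda(\Omega)$ and $(x,y)\in\mathcal C_1\times\mathcal C_2$ the operator $Tx+[Z,T]y$ is of trace class, and the pairing $$(T,(x,y))\mapsto \operatorname{Tr}\,(Tx+[Z,T]\,y)$$ induces an isometric linear isomorphism of the quotient $(\mathcal C_1\times\mathcal C_2)/\mathcal N$, with the quotient norm, onto the Banach space dual of $K\Lambda(\Omega)$. -/

import Mathlib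

open MeasureTheory
open scoped ENNReal InnerProductSpace

noncomputable section

namespace ELam

/-! ### Trace, trace class and Hilbert--Schmidt class of a complex Hilbert space -/

section Schatten

variable {H : Type*} [NormedAddCommGroup H] [InnerProductSpace ℂ H] [CompleteSpace H]

/-- The index set of a fixed orthonormal (Hilbert) basis of `H`. -/
def basisSet (H : Type*) [NormedAddCommGroup H] [InnerProductSpace ℂ H] [CompleteSpace H] :
    Set H :=
  (exists_hilbertBasis ℂ H).choose

/-- A fixed orthonormal (Hilbert) basis of `H`. -/
def basis (H : Type*) [NormedAddCommGroup H] [InnerProductSpace ℂ H] [CompleteSpace H] :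
    HilbertBasis (basisSet H) ℂ H :=
  (exists_hilbertBasis ℂ H).choose_spec.choose

/-- `Tr A = ∑ ⟪e_i, A e_i⟫ ∈ [0, ∞]` for a positive operator `A`. -/
def posTrace (A : H →L[ℂ] H) : ℝ≥0∞ :=
  ∑' i, ENNReal.ofReal (RCLike.re ⟪basis H i, A (basis H i)⟫_ℂ)

/-- The trace norm `|T|₁ = Tr (T⋆T)^(1/2)`, with value `∞` off the trace class. -/
def traceNorm (T : H →L[ℂ] H) : ℝ≥0∞ := posTrace (CFC.sqrt (star T * T))

/-- The Hilbert--Schmidt norm `|T|₂ = (Tr T⋆T)^(1/2)`, with value `∞` off the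
Hilbert--Schmidt class. -/
def hsNorm (T : H →L[ℂ] H) : ℝ≥0∞ := posTrace (star T * T) ^ (1 / 2 : ℝ)

/-- `T` belongs to the trace class. -/
def IsTraceClass (T : H →L[ℂ] H) : Prop := traceNorm T < ∞

/-- `T` belongs to the Hilbert--Schmidt class. -/
def IsHilbertSchmidt (T : H →L[ℂ] H) : Prop := hsNorm T < ∞

/-- The trace `Tr T = ∑ ⟪e_i, T e_i⟫` of a trace-class operator. -/
def trace (T : H →L[ℂ] H) : ℂ := ∑' i, ⟪basis H i, T (basis H i)⟫_ℂ

/-- The sum `∑ ‖T e_i‖²` along a Hilbert basis. -/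
def hsSum {ι : Type*} (b : HilbertBasis ι ℂ H) (T : H →L[ℂ] H) : ℝ≥0∞ :=
  ∑' i, ENNReal.ofReal (‖T (b i)‖ ^ 2)


theorem ofReal_norm_sq {ι : Type*} (b : HilbertBasis ι ℂ H) (x : H) :
    ENNReal.ofReal (‖x‖ ^ 2) = ∑' i, ENNReal.ofReal (‖⟪b i, x⟫_ℂ‖ ^ 2) := by
  have h := (b.hasSum_inner_mul_inner x x).mapL Complex.reCLM
  have h2 : HasSum (fun i => ‖⟪b i, x⟫_ℂ‖ ^ 2) (‖x‖ ^ 2) := by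
    convert h using 1
    · funext i
      rw [← inner_conj_symm x (b i), Complex.conj_mul']
      simp [← Complex.ofReal_pow]
    · rw [inner_self_eq_norm_sq_to_K]
      simp [← Complex.ofReal_pow]
  rw [← h2.tsum_eq, ENNReal.ofReal_tsum_of_nonneg (fun i => by positivity) h2.summable]

theorem hsSum_adjoint {ι κ : Type*} (b : HilbertBasis ι ℂ H) (c : HilbertBasis κ ℂ H)
    (T : H →L[ℂ] H) : hsSum b T = hsSum c (star T) := by
  unfold hsSum
  simp_rw [ofReal_norm_sq c (T _), ofReal_norm_sq b (star T _)]
  rw [ENNReal.tsum_comm]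
  refine tsum_congr fun j => tsum_congr fun i => ?_
  rw [ContinuousLinearMap.star_eq_adjoint, ContinuousLinearMap.adjoint_inner_right,
    ← inner_conj_symm, Complex.norm_conj]

theorem hsSum_indep {ι κ : Type*} (b : HilbertBasis ι ℂ H) (c : HilbertBasis κ ℂ H)
    (T : H →L[ℂ] H) : hsSum b T = hsSum c T := by
  rw [hsSum_adjoint b b, hsSum_adjoint b c, star_star]

theorem posTrace_star_mul_self {ι : Type*} (b : HilbertBasis ι ℂ H) (T : H →L[ℂ] H) :
    posTrace (star T * T) = hsSum b T := by
  rw [hsSum_indep b (basis H)]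
  refine tsum_congr fun i => ?_
  rw [mul_apply_eq_comp, ContinuousLinearMap.star_eq_adjoint,
    ContinuousLinearMap.adjoint_inner_right, inner_self_eq_norm_sq]

theorem hsNorm_eq {ι : Type*} (b : HilbertBasis ι ℂ H) (T : H →L[ℂ] H) :
    hsNorm T = hsSum b T ^ (1 / 2 : ℝ) := by
  rw [hsNorm, posTrace_star_mul_self b]

theorem posTrace_eq {ι : Type*} (b : HilbertBasis ι ℂ H) {A : H →L[ℂ] H} (hA : 0 ≤ A) :
    posTrace A = hsSum b (CFC.sqrt A) := by
  rw [← posTrace_star_mul_self b, (CFC.sqrt_nonneg A).isSelfAdjoint.star_eq,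
    CFC.sqrt_mul_sqrt_self A hA]

theorem hsSum_mul_le {ι : Type*} (b : HilbertBasis ι ℂ H) {V : H →L[ℂ] H} (hV : ‖V‖ ≤ 1)
    (T : H →L[ℂ] H) : hsSum b (V * T) ≤ hsSum b T := by
  refine ENNReal.tsum_le_tsum fun i => ENNReal.ofReal_le_ofReal ?_
  gcongr
  calc ‖V (T (b i))‖ ≤ ‖V‖ * ‖T (b i)‖ := V.le_opNorm _
    _ ≤ 1 * ‖T (b i)‖ := by gcongr
    _ = ‖T (b i)‖ := one_mul _

theorem eq_zero_of_hsSum {ι : Type*} (b : HilbertBasis ι ℂ H) {T : H →L[ℂ] H}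
    (h : hsSum b T = 0) : T = 0 := by
  have h0 : ∀ i, T (b i) = 0 := by
    intro i
    have := ENNReal.tsum_eq_zero.1 h i
    rw [ENNReal.ofReal_eq_zero] at this
    have h2 : ‖T (b i)‖ ^ 2 = 0 := le_antisymm this (by positivity)
    simpa using h2
  refine ContinuousLinearMap.ext_on (s := Set.range b) ?_ ?_
  · have := b.dense_span
    rw [Submodule.dense_iff_topologicalClosure_eq_top]
    exact this
  · rintro _ ⟨i, rfl⟩
    simpa using h0 i

theorem hsNorm_add_le (S T : H →L[ℂ] H) : hsNorm (S + T) ≤ hsNorm S + hsNorm T := by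
  have e : ∀ R : H →L[ℂ] H, hsNorm R = (∑' i, (‖R (basis H i)‖ₑ) ^ (2 : ℝ)) ^ (1 / 2 : ℝ) := by
    intro R
    rw [hsNorm_eq (basis H), hsSum]
    congr 1
    refine tsum_congr fun i => ?_
    rw [ENNReal.ofReal_pow (norm_nonneg _), ofReal_norm]
    norm_cast
  rw [e, e, e, one_div, ENNReal.rpow_inv_le_iff two_pos]
  rw [ENNReal.tsum_eq_iSup_sum]
  refine iSup_le fun s => ?_
  rw [← ENNReal.rpow_inv_le_iff two_pos, ← one_div]
  calc (∑ i ∈ s, ‖(S + T) (basis H i)‖ₑ ^ (2 : ℝ)) ^ (1 / 2 : ℝ)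
      ≤ (∑ i ∈ s, (‖S (basis H i)‖ₑ + ‖T (basis H i)‖ₑ) ^ (2 : ℝ)) ^ (1 / 2 : ℝ) := by
        gcongr with i _
        exact enorm_add_le _ _
    _ ≤ (∑ i ∈ s, ‖S (basis H i)‖ₑ ^ (2 : ℝ)) ^ (1 / 2 : ℝ)
        + (∑ i ∈ s, ‖T (basis H i)‖ₑ ^ (2 : ℝ)) ^ (1 / 2 : ℝ) :=
        ENNReal.Lp_add_le s _ _ one_le_two
    _ ≤ _ := by
        rw [one_div]
        gcongr <;> exact ENNReal.sum_le_tsum s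

theorem posTrace_smul {r : ℝ} (hr : 0 ≤ r) (A : H →L[ℂ] H) :
    posTrace (r • A) = ENNReal.ofReal r * posTrace A := by
  rw [posTrace, posTrace, ← ENNReal.tsum_mul_left]
  refine tsum_congr fun i => ?_
  rw [← ENNReal.ofReal_mul hr]
  congr 1
  rw [smul_apply, inner_smul_right_eq_smul]
  simp

theorem hsNorm_smul (c : ℂ) (T : H →L[ℂ] H) : hsNorm (c • T) = ‖c‖ₑ * hsNorm T := by
  have h : star (c • T) * (c • T) = (‖c‖ ^ 2 : ℝ) • (star T * T) := by
    rw [star_smul, smul_mul_smul_comm]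
    rw [show star c * c = ((‖c‖ ^ 2 : ℝ) : ℂ) by
      rw [Complex.star_def, Complex.conj_mul']; push_cast; rfl]
    exact Complex.coe_smul _ _
  rw [hsNorm, hsNorm, h, posTrace_smul (by positivity), ENNReal.mul_rpow_of_nonneg _ _ (by norm_num),
    ENNReal.ofReal_pow (norm_nonneg _), ofReal_norm, ← ENNReal.rpow_natCast, ← ENNReal.rpow_mul]
  norm_num

theorem norm_sqrt_apply (T : H →L[ℂ] H) (x : H) :
    ‖CFC.sqrt (star T * T) x‖ = ‖T x‖ := by
  have h1 : star (CFC.sqrt (star T * T)) * CFC.sqrt (star T * T) = star T * T := by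
    rw [(CFC.sqrt_nonneg _).isSelfAdjoint.star_eq,
      CFC.sqrt_mul_sqrt_self _ (star_mul_self_nonneg T)]
  have h2 : ∀ R : H →L[ℂ] H, ⟪x, (star R * R) x⟫_ℂ = ((‖R x‖ ^ 2 : ℝ) : ℂ) := by
    intro R
    rw [mul_apply_eq_comp, ContinuousLinearMap.star_eq_adjoint,
      ContinuousLinearMap.adjoint_inner_right, inner_self_eq_norm_sq_to_K]
    push_cast; rfl
  have h3 := h2 (CFC.sqrt (star T * T))
  rw [h1, h2 T, Complex.ofReal_inj] at h3
  exact ((sq_eq_sq₀ (norm_nonneg _) (norm_nonneg _)).1 h3).symm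

/-- A contraction `U` with `T = U |T|` and `|T| = U⋆ T`. -/
theorem exists_polar (T : H →L[ℂ] H) : ∃ U : H →L[ℂ] H, ‖U‖ ≤ 1 ∧
    T = U * CFC.sqrt (star T * T) ∧ CFC.sqrt (star T * T) = star U * T := by
  set A := CFC.sqrt (star T * T) with hA
  have hAT : ∀ x, ‖A x‖ = ‖T x‖ := norm_sqrt_apply T
  let K : Submodule ℂ H := (LinearMap.range A.toLinearMap).topologicalClosure
  have hmem : ∀ x, A x ∈ K := fun x =>
    Submodule.le_topologicalClosure _ (LinearMap.mem_range_self _ x)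
  let e : H →ₗ[ℂ] K := A.toLinearMap.codRestrict K hmem
  have : CompleteSpace K :=
    (Submodule.isClosed_topologicalClosure _).completeSpace_coe
  have hd : DenseRange e := by
    intro k
    rw [closure_subtype]
    have : (Subtype.val '' Set.range e) = (LinearMap.range A.toLinearMap : Set H) := by
      ext y
      simp [e]
    rw [this]
    exact k.2
  have hn : ∀ x, ‖T.toLinearMap x‖ ≤ 1 * ‖e x‖ := by
    intro x
    rw [one_mul]
    exact (hAT x).ge
  let W : K →L[ℂ] H := T.toLinearMap.extendOfNorm e
  have hW : ∀ x, W (e x) = T x := LinearMap.extendOfNorm_eq hd ⟨1, hn⟩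
  have hW1 : ∀ k, ‖W k‖ ≤ 1 * ‖k‖ := LinearMap.norm_extendOfNorm_apply_le hd 1 hn
  let U : H →L[ℂ] H := W ∘L K.orthogonalProjectionOnto
  have hU1 : ‖U‖ ≤ 1 := by
    refine ContinuousLinearMap.opNorm_le_bound _ zero_le_one fun x => ?_
    refine (hW1 _).trans ?_
    gcongr
    exact K.norm_orthogonalProjectionOnto_apply_le x
  have hUA : ∀ x, U (A x) = T x := by
    intro x
    have : K.orthogonalProjectionOnto (A x) = e x :=
      K.orthogonalProjectionOnto_mem_subspace_eq_self (e x)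
    exact (congrArg W this).trans (hW x)
  refine ⟨U, hU1, ?_, ?_⟩
  · ext x
    exact (hUA x).symm
  · ext x
    rw [mul_apply_eq_comp, ← hUA x]
    have hn2 : ‖star U (U (A x))‖ ≤ ‖A x‖ := by
      calc ‖star U (U (A x))‖ ≤ ‖star U‖ * ‖U (A x)‖ := (star U).le_opNorm _
        _ ≤ 1 * ‖U (A x)‖ := by rw [norm_star]; gcongr
        _ = ‖A x‖ := by rw [one_mul, hUA, hAT]
    have hin : RCLike.re ⟪A x, star U (U (A x))⟫_ℂ = ‖A x‖ ^ 2 := by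
      rw [ContinuousLinearMap.star_eq_adjoint, ContinuousLinearMap.adjoint_inner_right,
        inner_self_eq_norm_sq, hUA, hAT]
    have h := norm_sub_sq (𝕜 := ℂ) (A x) (star U (U (A x)))
    rw [hin] at h
    have h4 : ‖star U (U (A x))‖ ^ 2 ≤ ‖A x‖ ^ 2 := by gcongr
    have h5 : ‖A x - star U (U (A x))‖ ^ 2 = 0 :=
      le_antisymm (by linarith) (by positivity)
    exact sub_eq_zero.1 (norm_eq_zero.1 (pow_eq_zero_iff two_ne_zero |>.1 h5))

theorem tsum_inner_le_traceNorm {V : H →L[ℂ] H} (hV : ‖V‖ ≤ 1) (T : H →L[ℂ] H) :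
    ∑' i, ‖⟪basis H i, V (T (basis H i))⟫_ℂ‖ₑ ≤ traceNorm T := by
  obtain ⟨U, hU, hT, -⟩ := exists_polar T
  have hA : 0 ≤ CFC.sqrt (star T * T) := CFC.sqrt_nonneg _
  set A := CFC.sqrt (star T * T) with hAdef
  set R := CFC.sqrt A with hR
  have hRR : R * R = A := CFC.sqrt_mul_sqrt_self A hA
  have hVU : ‖V * U‖ ≤ 1 := (norm_mul_le _ _).trans (mul_le_one₀ hV (norm_nonneg _) hU)
  have key : ∀ i, ‖⟪basis H i, V (T (basis H i))⟫_ℂ‖ₑ ≤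
      2⁻¹ * (ENNReal.ofReal (‖star (V * U * R) (basis H i)‖ ^ 2)
        + ENNReal.ofReal (‖R (basis H i)‖ ^ 2)) := by
    intro i
    have h1 : V (T (basis H i)) = (V * U * R) (R (basis H i)) := by
      conv_lhs => rw [hT, ← hRR]
      rfl
    have h2 : ‖⟪basis H i, V (T (basis H i))⟫_ℂ‖ ≤
        ‖star (V * U * R) (basis H i)‖ * ‖R (basis H i)‖ := by
      rw [h1, ← ContinuousLinearMap.adjoint_inner_left, ContinuousLinearMap.star_eq_adjoint]
      exact norm_inner_le_norm _ _
    rw [← ENNReal.ofReal_add (by positivity) (by positivity), ← ofReal_norm,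
      show (2⁻¹ : ℝ≥0∞) = ENNReal.ofReal 2⁻¹ by
        rw [ENNReal.ofReal_inv_of_pos two_pos]; simp,
      ← ENNReal.ofReal_mul (by norm_num)]
    refine ENNReal.ofReal_le_ofReal (h2.trans ?_)
    nlinarith [sq_nonneg (‖star (V * U * R) (basis H i)‖ - ‖R (basis H i)‖)]
  calc ∑' i, ‖⟪basis H i, V (T (basis H i))⟫_ℂ‖ₑ
      ≤ 2⁻¹ * (hsSum (basis H) (star (V * U * R)) + hsSum (basis H) R) := by
        rw [hsSum, hsSum, ← ENNReal.tsum_add, ← ENNReal.tsum_mul_left]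
        exact ENNReal.tsum_le_tsum key
    _ ≤ 2⁻¹ * (hsSum (basis H) R + hsSum (basis H) R) := by
        gcongr
        rw [← hsSum_adjoint (basis H)]
        exact hsSum_mul_le _ hVU R
    _ = hsSum (basis H) R := by
        rw [← two_mul, ← mul_assoc, ENNReal.inv_mul_cancel two_ne_zero ENNReal.ofNat_ne_top, one_mul]
    _ = traceNorm T := by
        rw [traceNorm, posTrace_eq (basis H) hA]

theorem traceNorm_add_le (S T : H →L[ℂ] H) :
    traceNorm (S + T) ≤ traceNorm S + traceNorm T := by
  obtain ⟨U, hU, -, hA⟩ := exists_polar (S + T)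
  have hU' : ‖star U‖ ≤ 1 := by rwa [norm_star]
  refine le_trans ?_ (add_le_add (tsum_inner_le_traceNorm hU' S) (tsum_inner_le_traceNorm hU' T))
  rw [← ENNReal.tsum_add, traceNorm, posTrace, hA]
  refine ENNReal.tsum_le_tsum fun i => ?_
  rw [mul_apply_eq_comp, add_apply, map_add, inner_add_right]
  refine le_trans ?_ (enorm_add_le _ _)
  rw [← ofReal_norm]
  exact ENNReal.ofReal_le_ofReal (RCLike.re_le_norm _)

theorem traceNorm_smul (c : ℂ) (T : H →L[ℂ] H) : traceNorm (c • T) = ‖c‖ₑ * traceNorm T := by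
  have h : CFC.sqrt (star (c • T) * (c • T)) = ‖c‖ • CFC.sqrt (star T * T) := CFC.abs_smul c T
  rw [traceNorm, h, posTrace_smul (norm_nonneg c), ofReal_norm, traceNorm]

theorem eq_zero_of_traceNorm {T : H →L[ℂ] H} (h : traceNorm T = 0) : T = 0 := by
  rw [traceNorm, posTrace_eq (basis H) (CFC.sqrt_nonneg _)] at h
  have h1 := eq_zero_of_hsSum _ h
  have h2 : CFC.sqrt (star T * T) = 0 := by
    rw [← CFC.sqrt_mul_sqrt_self (CFC.sqrt (star T * T)) (CFC.sqrt_nonneg _), h1, mul_zero]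
  obtain ⟨U, -, hT, -⟩ := exists_polar T
  rw [hT, h2, mul_zero]

theorem eq_zero_of_hsNorm {T : H →L[ℂ] H} (h : hsNorm T = 0) : T = 0 := by
  rw [hsNorm_eq (basis H), ENNReal.rpow_eq_zero_iff_of_pos (by norm_num)] at h
  exact eq_zero_of_hsSum _ h

variable (H) in
/-- The space `C₁(H)` of trace-class operators, as a subspace of `B(H)`. -/
def traceClassSubmodule : Submodule ℂ (H →L[ℂ] H) where
  carrier := {T | IsTraceClass T}
  add_mem' {S T} hS hT := (traceNorm_add_le S T).trans_lt (ENNReal.add_lt_top.2 ⟨hS, hT⟩)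
  zero_mem' := by
    have h := traceNorm_smul (0 : ℂ) (0 : H →L[ℂ] H)
    simp only [zero_smul, enorm_zero, zero_mul] at h
    simp [IsTraceClass, h]
  smul_mem' c T hT := by
    change traceNorm (c • T) < ∞
    rw [traceNorm_smul]
    exact ENNReal.mul_lt_top enorm_lt_top hT

variable (H) in
/-- The space `C₂(H)` of Hilbert--Schmidt operators, as a subspace of `B(H)`. -/
def hilbertSchmidtSubmodule : Submodule ℂ (H →L[ℂ] H) where
  carrier := {T | IsHilbertSchmidt T}
  add_mem' {S T} hS hT := (hsNorm_add_le S T).trans_lt (ENNReal.add_lt_top.2 ⟨hS, hT⟩)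
  zero_mem' := by
    have h := hsNorm_smul (0 : ℂ) (0 : H →L[ℂ] H)
    simp only [zero_smul, enorm_zero, zero_mul] at h
    simp [IsHilbertSchmidt, h]
  smul_mem' c T hT := by
    change hsNorm (c • T) < ∞
    rw [hsNorm_smul]
    exact ENNReal.mul_lt_top enorm_lt_top hT

variable (H) in
/-- `C₁(H)` as a normed space with the trace norm (a type synonym, so that it does not carry the
operator norm). -/
def TraceClass : Type _ := traceClassSubmodule H

variable (H) in
/-- `C₂(H)` as a normed space with the Hilbert--Schmidt norm (a type synonym, so that it does not
carry the operator norm). -/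
def HilbertSchmidt : Type _ := hilbertSchmidtSubmodule H

instance : AddCommGroup (TraceClass H) := inferInstanceAs (AddCommGroup (traceClassSubmodule H))
instance : Module ℂ (TraceClass H) := inferInstanceAs (Module ℂ (traceClassSubmodule H))
instance : AddCommGroup (HilbertSchmidt H) :=
  inferInstanceAs (AddCommGroup (hilbertSchmidtSubmodule H))
instance : Module ℂ (HilbertSchmidt H) := inferInstanceAs (Module ℂ (hilbertSchmidtSubmodule H))

/-- The operator underlying an element of `C₁(H)`. -/
def TraceClass.toOp : TraceClass H →ₗ[ℂ] (H →L[ℂ] H) := (traceClassSubmodule H).subtype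

/-- The operator underlying an element of `C₂(H)`. -/
def HilbertSchmidt.toOp : HilbertSchmidt H →ₗ[ℂ] (H →L[ℂ] H) := (hilbertSchmidtSubmodule H).subtype

theorem TraceClass.toOp_injective : Function.Injective (TraceClass.toOp (H := H)) :=
  Subtype.val_injective

theorem HilbertSchmidt.toOp_injective : Function.Injective (HilbertSchmidt.toOp (H := H)) :=
  Subtype.val_injective

theorem TraceClass.isTraceClass (x : TraceClass H) : IsTraceClass x.toOp := x.2

theorem HilbertSchmidt.isHilbertSchmidt (x : HilbertSchmidt H) : IsHilbertSchmidt x.toOp := x.2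

instance : Norm (TraceClass H) := ⟨fun x => (traceNorm x.toOp).toReal⟩
instance : Norm (HilbertSchmidt H) := ⟨fun x => (hsNorm x.toOp).toReal⟩

theorem TraceClass.norm_def (x : TraceClass H) : ‖x‖ = (traceNorm x.toOp).toReal := rfl

theorem HilbertSchmidt.norm_def (x : HilbertSchmidt H) : ‖x‖ = (hsNorm x.toOp).toReal := rfl

theorem TraceClass.core : NormedSpace.Core ℂ (TraceClass H) where
  norm_nonneg _ := ENNReal.toReal_nonneg
  norm_smul c x := by
    rw [norm_def, norm_def, map_smul, traceNorm_smul, ENNReal.toReal_mul, toReal_enorm]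
  norm_triangle x y := by
    rw [norm_def, norm_def, norm_def, map_add,
      ← ENNReal.toReal_add x.isTraceClass.ne y.isTraceClass.ne]
    exact ENNReal.toReal_mono (ENNReal.add_lt_top.2 ⟨x.isTraceClass, y.isTraceClass⟩).ne
      (traceNorm_add_le _ _)
  norm_eq_zero_iff x := by
    refine ⟨fun h => ?_, fun h => ?_⟩
    · rw [norm_def, ENNReal.toReal_eq_zero_iff] at h
      exact toOp_injective ((eq_zero_of_traceNorm (h.resolve_right x.isTraceClass.ne)).trans
        (map_zero _).symm)
    · have h2 := traceNorm_smul (0 : ℂ) (x.toOp)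
      rw [norm_def, h, map_zero]
      simp only [zero_smul, enorm_zero, zero_mul] at h2
      rw [h2, ENNReal.toReal_zero]

theorem HilbertSchmidt.core : NormedSpace.Core ℂ (HilbertSchmidt H) where
  norm_nonneg _ := ENNReal.toReal_nonneg
  norm_smul c x := by
    rw [norm_def, norm_def, map_smul, hsNorm_smul, ENNReal.toReal_mul, toReal_enorm]
  norm_triangle x y := by
    rw [norm_def, norm_def, norm_def, map_add,
      ← ENNReal.toReal_add x.isHilbertSchmidt.ne y.isHilbertSchmidt.ne]
    exact ENNReal.toReal_mono (ENNReal.add_lt_top.2 ⟨x.isHilbertSchmidt, y.isHilbertSchmidt⟩).ne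
      (hsNorm_add_le _ _)
  norm_eq_zero_iff x := by
    refine ⟨fun h => ?_, fun h => ?_⟩
    · rw [norm_def, ENNReal.toReal_eq_zero_iff] at h
      exact toOp_injective ((eq_zero_of_hsNorm (h.resolve_right x.isHilbertSchmidt.ne)).trans
        (map_zero _).symm)
    · have h2 := hsNorm_smul (0 : ℂ) (x.toOp)
      rw [norm_def, h, map_zero]
      simp only [zero_smul, enorm_zero, zero_mul] at h2
      rw [h2, ENNReal.toReal_zero]

instance : NormedAddCommGroup (TraceClass H) := NormedAddCommGroup.ofCore TraceClass.core
instance : NormedSpace ℂ (TraceClass H) := NormedSpace.ofCore TraceClass.core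
instance : NormedAddCommGroup (HilbertSchmidt H) := NormedAddCommGroup.ofCore HilbertSchmidt.core
instance : NormedSpace ℂ (HilbertSchmidt H) := NormedSpace.ofCore HilbertSchmidt.core

end Schatten

/-! ### The algebra `EΛ(Ω)` and its ideal `KΛ(Ω)` of compact operators -/

section Lip

/-- Lebesgue measure on `Ω ⊆ ℂ`. -/
abbrev leb (Ω : Set ℂ) : Measure ℂ := volume.restrict Ω

/-- The Hilbert space `L²(Ω, λ)`. -/
abbrev L2 (Ω : Set ℂ) : Type := Lp ℂ 2 (leb Ω)

/-- The bounded operators on `L²(Ω, λ)`. -/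
abbrev Op (Ω : Set ℂ) : Type := L2 Ω →L[ℂ] L2 Ω

/-- The commutator `[A, B] = AB - BA`. -/
def comm {Ω : Set ℂ} (A B : Op Ω) : Op Ω := A * B - B * A

theorem comm_add {Ω : Set ℂ} (A B C : Op Ω) : comm A (B + C) = comm A B + comm A C := by
  simp only [comm, mul_add, add_mul]; abel

theorem comm_smul {Ω : Set ℂ} (c : ℂ) (A B : Op Ω) : comm A (c • B) = c • comm A B := by
  simp only [comm, mul_smul_comm, smul_mul_assoc, smul_sub]

theorem comm_zero {Ω : Set ℂ} (A : Op Ω) : comm A 0 = 0 := by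
  simp [comm]

/-- The operator `M_f` of multiplication by `f ∈ L^∞(Ω, λ)` on `L²(Ω, λ)`. -/
def mulOp {Ω : Set ℂ} (f : Lp ℂ ∞ (leb Ω)) : Op Ω :=
  (ContinuousLinearMap.mul ℂ ℂ).holderL (leb Ω) ∞ 2 2 f

/-- The difference quotient `Df(s, t) = (f(s) - f(t)) / (s - t)`; the diagonal, where it is `0`,
is a null set. -/
def diffQuot (f : ℂ → ℂ) (p : ℂ × ℂ) : ℂ := (f p.1 - f p.2) / (p.1 - p.2)

/-- The set `Λ(Ω)` of essentially Lipschitz functions `f ∈ L^∞(Ω, λ)`. -/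
def Lam (Ω : Set ℂ) : Set (Lp ℂ ∞ (leb Ω)) :=
  {f | MemLp (diffQuot f) ∞ ((leb Ω).prod (leb Ω))}

/-- `L(T) = sup {|[M_f, T]|₂ : f ∈ Λ(Ω), ‖Df‖_∞ ≤ 1} ∈ [0, ∞]`. -/
def lipNorm {Ω : Set ℂ} (T : Op Ω) : ℝ≥0∞ :=
  ⨆ f ∈ {f : Lp ℂ ∞ (leb Ω) |
    f ∈ Lam Ω ∧ eLpNorm (diffQuot f) ∞ ((leb Ω).prod (leb Ω)) ≤ 1},
    hsNorm (comm (mulOp f) T)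

theorem lipNorm_add_le {Ω : Set ℂ} (S T : Op Ω) : lipNorm (S + T) ≤ lipNorm S + lipNorm T := by
  refine iSup₂_le fun f hf => ?_
  rw [comm_add]
  exact (hsNorm_add_le _ _).trans (add_le_add
    (le_iSup₂ (f := fun g _ => hsNorm (comm (mulOp g) S)) f hf)
    (le_iSup₂ (f := fun g _ => hsNorm (comm (mulOp g) T)) f hf))

theorem lipNorm_smul {Ω : Set ℂ} (c : ℂ) (T : Op Ω) : lipNorm (c • T) = ‖c‖ₑ * lipNorm T := by
  simp only [lipNorm, ENNReal.mul_iSup, ← hsNorm_smul]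
  simp only [comm_smul]

/-- `EΛ(Ω) = {T ∈ B(L²(Ω, λ)) : L(T) < ∞}`, as a linear space. -/
def ELambda (Ω : Set ℂ) : Submodule ℂ (Op Ω) where
  carrier := {T | lipNorm T < ∞}
  add_mem' {S T} hS hT := (lipNorm_add_le S T).trans_lt (ENNReal.add_lt_top.2 ⟨hS, hT⟩)
  zero_mem' := by
    have h := lipNorm_smul (0 : ℂ) (0 : Op Ω)
    simp only [zero_smul, enorm_zero, zero_mul] at h
    simp [h]
  smul_mem' c T hT := by
    change lipNorm (c • T) < ∞
    rw [lipNorm_smul]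
    exact ENNReal.mul_lt_top enorm_lt_top hT

/-- `KΛ(Ω)`, the compact operators in `EΛ(Ω)`, as a subspace of `B(L²(Ω, λ))`. -/
def kLambdaSubmodule (Ω : Set ℂ) : Submodule ℂ (Op Ω) :=
  ELambda Ω ⊓ compactOperator (RingHom.id ℂ) (L2 Ω) (L2 Ω)

/-- `KΛ(Ω)` as a normed space with the norm `‖T‖ + L(T)` (a type synonym, so that it does not
carry the operator norm). -/
def KLambda (Ω : Set ℂ) : Type := kLambdaSubmodule Ω

variable {Ω : Set ℂ}

instance : AddCommGroup (KLambda Ω) := inferInstanceAs (AddCommGroup (kLambdaSubmodule Ω))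
instance : Module ℂ (KLambda Ω) := inferInstanceAs (Module ℂ (kLambdaSubmodule Ω))

/-- The operator underlying an element of `KΛ(Ω)`. -/
def KLambda.toOp : KLambda Ω →ₗ[ℂ] Op Ω := (kLambdaSubmodule Ω).subtype

theorem KLambda.toOp_injective : Function.Injective (KLambda.toOp (Ω := Ω)) :=
  Subtype.val_injective

theorem KLambda.lipNorm_lt_top (T : KLambda Ω) : lipNorm T.toOp < ∞ := T.2.1

theorem KLambda.isCompactOperator (T : KLambda Ω) : IsCompactOperator T.toOp := T.2.2

instance : Norm (KLambda Ω) := ⟨fun T => ‖T.toOp‖ + (lipNorm T.toOp).toReal⟩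

theorem KLambda.norm_def (T : KLambda Ω) : ‖T‖ = ‖T.toOp‖ + (lipNorm T.toOp).toReal := rfl

theorem KLambda.core : NormedSpace.Core ℂ (KLambda Ω) where
  norm_nonneg _ := add_nonneg (norm_nonneg _) ENNReal.toReal_nonneg
  norm_smul c T := by
    rw [norm_def, norm_def, map_smul, lipNorm_smul, ENNReal.toReal_mul, toReal_enorm, norm_smul,
      mul_add]
  norm_triangle S T := by
    have h : (lipNorm (S.toOp + T.toOp)).toReal
        ≤ (lipNorm S.toOp).toReal + (lipNorm T.toOp).toReal := by
      rw [← ENNReal.toReal_add S.lipNorm_lt_top.ne T.lipNorm_lt_top.ne]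
      exact ENNReal.toReal_mono (ENNReal.add_lt_top.2 ⟨S.lipNorm_lt_top, T.lipNorm_lt_top⟩).ne
        (lipNorm_add_le _ _)
    rw [norm_def, norm_def, norm_def, map_add]
    linarith [norm_add_le S.toOp T.toOp]
  norm_eq_zero_iff T := by
    refine ⟨fun h => ?_, fun h => ?_⟩
    · rw [norm_def] at h
      have h0 : ‖T.toOp‖ = 0 := le_antisymm
        (by linarith [ENNReal.toReal_nonneg (a := lipNorm T.toOp)]) (norm_nonneg _)
      exact toOp_injective ((norm_eq_zero.1 h0).trans (map_zero _).symm)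
    · have h2 := lipNorm_smul (0 : ℂ) (T.toOp)
      rw [norm_def, h, map_zero]
      simp only [zero_smul, enorm_zero, zero_mul] at h2
      rw [h2, ENNReal.toReal_zero, norm_zero, add_zero]

instance : NormedAddCommGroup (KLambda Ω) := NormedAddCommGroup.ofCore KLambda.core
instance : NormedSpace ℂ (KLambda Ω) := NormedSpace.ofCore KLambda.core

theorem memLp_id (hm : MeasurableSet Ω) (hb : Bornology.IsBounded Ω) :
    MemLp (fun z : ℂ => z) ∞ (leb Ω) := by
  obtain ⟨C, hC⟩ := hb.exists_norm_le
  exact memLp_top_of_bound measurable_id.aestronglyMeasurable C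
    (ae_restrict_of_forall_mem hm hC)

/-- The operator `Z` of multiplication by the coordinate `z` on `L²(Ω, λ)`, for bounded `Ω`. -/
def opZ (hm : MeasurableSet Ω) (hb : Bornology.IsBounded Ω) : Op Ω :=
  mulOp ((memLp_id hm hb).toLp (fun z : ℂ => z))

/-- `N = {([Z, h], h) : h ∈ C₂, [Z, h] ∈ C₁} ⊆ C₁ × C₂`. -/
def annN (hm : MeasurableSet Ω) (hb : Bornology.IsBounded Ω) :
    Submodule ℂ (TraceClass (L2 Ω) × HilbertSchmidt (L2 Ω)) where
  carrier := {p | p.1.toOp = comm (opZ hm hb) p.2.toOp}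
  add_mem' {p q} hp hq := by
    change (p.1 + q.1).toOp = comm (opZ hm hb) (p.2 + q.2).toOp
    rw [map_add, map_add, comm_add, hp, hq]
  zero_mem' := by
    change (0 : TraceClass (L2 Ω)).toOp = comm (opZ hm hb) (0 : HilbertSchmidt (L2 Ω)).toOp
    rw [map_zero, map_zero, comm_zero]
  smul_mem' c p hp := by
    change (c • p.1).toOp = comm (opZ hm hb) (c • p.2).toOp
    rw [map_smul, map_smul, comm_smul, hp]

end Lip

end ELam

end

/-!
The commutator `[Z, T]` alone controls `[M_f, T]` for every `1`-Lipschitz `f`: cutting `Ω` into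
small cells and compressing to the span of their indicators makes `Z` and `M_f` approximately
diagonal, and for diagonal operators the entries of the commutators are `(z_i - z_j) T_ij` and
`(f_i - f_j) T_ij`. For compact `T` the compressions converge, so `L(T) = |[Z, T]|₂`, and
`T ↦ (T, [Z, T])` embeds `KΛ(Ω)` isometrically into the `ℓ¹`-sum of the compact operators and `C₂`.

By Hahn--Banach every functional on `KΛ(Ω)` is the restriction of one on that sum with the same
norm, and the dual of the sum is `C₁ × C₂` with the maximum norm: the pairing is onto and realises
the quotient norm. Its kernel is found by testing on rank-one operators; that it contains `N` comes
down to `Tr [Z, X] = 0` for Hilbert--Schmidt `X` with `[Z, X]` of trace class, which the same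
compressions prove.
-/

noncomputable section

namespace ELam

open Filter Topology InnerProductSpace
open scoped NNReal

theorem enorm_inner_symm {𝕜 E : Type*} [RCLike 𝕜] [SeminormedAddCommGroup E]
    [InnerProductSpace 𝕜 E] (x y : E) : ‖⟪x, y⟫_𝕜‖ₑ = ‖⟪y, x⟫_𝕜‖ₑ := by
  rw [← ofReal_norm, norm_inner_symm, ofReal_norm]

section Schatten

variable {H : Type*} [NormedAddCommGroup H] [InnerProductSpace ℂ H] [CompleteSpace H]

/-! ### Hilbert--Schmidt operators -/

theorem hsNorm_eq_tsum_rpow {ι : Type*} (b : HilbertBasis ι ℂ H) (T : H →L[ℂ] H) :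
    hsNorm T = (∑' i, ‖T (b i)‖ₑ ^ (2 : ℝ)) ^ (1 / 2 : ℝ) := by
  rw [hsNorm_eq b, hsSum]
  congr 1
  refine tsum_congr fun i => ?_
  rw [ENNReal.ofReal_pow (norm_nonneg _), ofReal_norm, ENNReal.rpow_ofNat]

theorem hsNorm_sq {ι : Type*} (b : HilbertBasis ι ℂ H) (T : H →L[ℂ] H) :
    hsNorm T ^ 2 = ∑' i, ‖T (b i)‖ₑ ^ 2 := by
  rw [hsNorm_eq_tsum_rpow b, ← ENNReal.rpow_ofNat, ← ENNReal.rpow_mul, one_div,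
    inv_mul_cancel₀ two_ne_zero, ENNReal.rpow_one]
  simp only [ENNReal.rpow_ofNat]

theorem enorm_sq_eq_tsum {ι : Type*} (b : HilbertBasis ι ℂ H) (x : H) :
    ‖x‖ₑ ^ 2 = ∑' i, ‖⟪b i, x⟫_ℂ‖ₑ ^ 2 := by
  simp only [← ofReal_norm, ← ENNReal.ofReal_pow (norm_nonneg _), ofReal_norm_sq b]

theorem hsNorm_sq_eq_tsum_tsum {ι κ : Type*} (b : HilbertBasis ι ℂ H) (c : HilbertBasis κ ℂ H)
    (T : H →L[ℂ] H) : hsNorm T ^ 2 = ∑' i, ∑' k, ‖⟪c k, T (b i)⟫_ℂ‖ₑ ^ 2 := by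
  simp only [hsNorm_sq b, ← enorm_sq_eq_tsum c]

theorem hsNorm_le_iff {T : H →L[ℂ] H} {c : ℝ≥0∞} : hsNorm T ≤ c ↔ hsNorm T ^ 2 ≤ c ^ 2 :=
  (ENNReal.pow_le_pow_left_iff two_ne_zero).symm

theorem hsNorm_star (T : H →L[ℂ] H) : hsNorm (star T) = hsNorm T := by
  rw [hsNorm_eq (basis H), hsNorm_eq (basis H), hsSum_adjoint (basis H) (basis H) T]

theorem enorm_star_op (T : H →L[ℂ] H) : ‖star T‖ₑ = ‖T‖ₑ := by
  rw [← ofReal_norm, ← ofReal_norm, norm_star]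

theorem hsNorm_mul_le (A B : H →L[ℂ] H) : hsNorm (A * B) ≤ ‖A‖ₑ * hsNorm B := by
  rw [hsNorm_le_iff, mul_pow, hsNorm_sq (basis H), hsNorm_sq (basis H), ← ENNReal.tsum_mul_left]
  refine ENNReal.tsum_le_tsum fun i => ?_
  rw [← mul_pow]
  gcongr
  exact A.le_opENorm _

theorem hsNorm_mul_le' (A B : H →L[ℂ] H) : hsNorm (A * B) ≤ hsNorm A * ‖B‖ₑ := by
  rw [← hsNorm_star, star_mul, mul_comm (hsNorm A), ← hsNorm_star A, ← enorm_star_op B]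
  exact hsNorm_mul_le _ _

theorem hsNorm_neg (T : H →L[ℂ] H) : hsNorm (-T) = hsNorm T := by
  rw [← neg_one_smul ℂ T, hsNorm_smul]
  simp

theorem hsNorm_sub_le (S T : H →L[ℂ] H) : hsNorm (S - T) ≤ hsNorm S + hsNorm T := by
  rw [sub_eq_add_neg, ← hsNorm_neg T]
  exact hsNorm_add_le _ _

theorem IsHilbertSchmidt.mul_left {B : H →L[ℂ] H} (hB : IsHilbertSchmidt B) (A : H →L[ℂ] H) :
    IsHilbertSchmidt (A * B) :=
  (hsNorm_mul_le A B).trans_lt (ENNReal.mul_lt_top enorm_lt_top hB)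

theorem IsHilbertSchmidt.mul_right {A : H →L[ℂ] H} (hA : IsHilbertSchmidt A) (B : H →L[ℂ] H) :
    IsHilbertSchmidt (A * B) :=
  (hsNorm_mul_le' A B).trans_lt (ENNReal.mul_lt_top hA enorm_lt_top)

theorem IsHilbertSchmidt.sub {A B : H →L[ℂ] H} (hA : IsHilbertSchmidt A)
    (hB : IsHilbertSchmidt B) : IsHilbertSchmidt (A - B) :=
  (hsNorm_sub_le A B).trans_lt (ENNReal.add_lt_top.2 ⟨hA, hB⟩)

theorem tendsto_hsNorm_mul {α : Type*} {l : Filter α} {D : α → H →L[ℂ] H} {c : ℝ}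
    (hc : ∀ n, ‖D n‖ ≤ c) (hD : ∀ x, Tendsto (fun n => D n x) l (𝓝 0))
    {B : H →L[ℂ] H} (hB : IsHilbertSchmidt B) :
    Tendsto (fun n => hsNorm (D n * B)) l (𝓝 0) := by
  have hsum : Summable fun i => ‖B (basis H i)‖ ^ 2 := by
    have hfin : ∑' i, ‖B (basis H i)‖ₑ ^ 2 ≠ ∞ :=
      hsNorm_sq (basis H) B ▸ (ENNReal.pow_lt_top hB).ne
    exact (ENNReal.summable_toReal hfin).congr fun i => by simp
  have hle (n : α) (i) : ‖(D n * B) (basis H i)‖ ^ 2 ≤ c ^ 2 * ‖B (basis H i)‖ ^ 2 := by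
    rw [← mul_pow]
    gcongr
    exact (D n).le_of_opNorm_le (hc n) _
  have htsum : Tendsto (fun n => ∑' i, ‖(D n * B) (basis H i)‖ ^ 2) l
      (𝓝 (∑' _ : basisSet H, (0 : ℝ))) := by
    refine tendsto_tsum_of_dominated_convergence (hsum.mul_left (c ^ 2)) (fun i => ?_)
      (Eventually.of_forall fun n i => ?_)
    · simpa using (hD (B (basis H i))).norm.pow 2
    · rw [Real.norm_of_nonneg (by positivity)]
      exact hle n i
  have hlim := (ENNReal.tendsto_ofReal htsum).ennrpow_const (1 / 2 : ℝ)
  rw [tsum_zero, ENNReal.ofReal_zero, ENNReal.zero_rpow_of_pos (by norm_num)] at hlim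
  refine hlim.congr fun n => ?_
  rw [hsNorm_eq (basis H), hsSum, ENNReal.ofReal_tsum_of_nonneg (fun i => by positivity)
    (.of_nonneg_of_le (fun i => by positivity) (hle n) (hsum.mul_left _))]

theorem hsNorm_le_of_tendsto {α : Type*} {l : Filter α} [l.NeBot] {K : α → H →L[ℂ] H}
    {T : H →L[ℂ] H} (hK : ∀ x, Tendsto (fun n => K n x) l (𝓝 (T x))) {c : α → ℝ≥0∞} {c₀ : ℝ≥0∞}
    (hle : ∀ n, hsNorm (K n) ≤ c n) (hc : Tendsto c l (𝓝 c₀)) : hsNorm T ≤ c₀ := by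
  rw [hsNorm_le_iff, hsNorm_sq (basis H), ENNReal.tsum_eq_iSup_sum]
  refine iSup_le fun s => le_of_tendsto_of_tendsto'
    (tendsto_finsetSum s fun i _ => ENNReal.Tendsto.pow (hK (basis H i)).enorm)
    (ENNReal.Tendsto.pow hc) fun n => ?_
  calc ∑ i ∈ s, ‖K n (basis H i)‖ₑ ^ 2 ≤ hsNorm (K n) ^ 2 :=
        (ENNReal.sum_le_tsum s).trans_eq (hsNorm_sq (basis H) (K n)).symm
    _ ≤ c n ^ 2 := by gcongr; exact hle n

theorem tsum_inner_le_hsNorm_mul (A B : H →L[ℂ] H) :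
    ∑' i, ‖⟪A (basis H i), B (basis H i)⟫_ℂ‖ₑ ≤ hsNorm A * hsNorm B := by
  rw [hsNorm_eq_tsum_rpow (basis H), hsNorm_eq_tsum_rpow (basis H), ENNReal.tsum_eq_iSup_sum]
  refine iSup_le fun s => ?_
  calc ∑ i ∈ s, ‖⟪A (basis H i), B (basis H i)⟫_ℂ‖ₑ
      ≤ ∑ i ∈ s, ‖A (basis H i)‖ₑ * ‖B (basis H i)‖ₑ := by
        refine Finset.sum_le_sum fun i _ => ?_
        rw [← ofReal_norm, ← ofReal_norm, ← ofReal_norm, ← ENNReal.ofReal_mul (norm_nonneg _)]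
        exact ENNReal.ofReal_le_ofReal (norm_inner_le_norm _ _)
    _ ≤ (∑ i ∈ s, ‖A (basis H i)‖ₑ ^ (2 : ℝ)) ^ (1 / 2 : ℝ)
        * (∑ i ∈ s, ‖B (basis H i)‖ₑ ^ (2 : ℝ)) ^ (1 / 2 : ℝ) :=
        ENNReal.inner_le_Lp_mul_Lq s _ _ Real.HolderConjugate.two_two
    _ ≤ _ := by
        gcongr <;> exact ENNReal.sum_le_tsum s

/-! ### Trace-class operators -/

theorem traceNorm_le_of_forall_enorm_sum_inner_le {T : H →L[ℂ] H} {C : ℝ≥0∞}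
    (h : ∀ V : H →L[ℂ] H, ‖V‖ ≤ 1 → ∀ s : Finset (basisSet H),
      ‖∑ i ∈ s, ⟪basis H i, V (T (basis H i))⟫_ℂ‖ₑ ≤ C) :
    traceNorm T ≤ C := by
  obtain ⟨U, hU, -, habs⟩ := exists_polar T
  have hpos : (CFC.sqrt (star T * T)).IsPositive :=
    (ContinuousLinearMap.nonneg_iff_isPositive _).1 (CFC.sqrt_nonneg _)
  rw [traceNorm, posTrace, ENNReal.tsum_eq_iSup_sum]
  refine iSup_le fun s => ?_
  rw [← ENNReal.ofReal_sum_of_nonneg fun i _ => hpos.re_inner_nonneg_right (basis H i), ← map_sum]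
  refine le_trans ?_ (h (star U) (by rwa [norm_star]) s)
  rw [← ofReal_norm, habs]
  exact ENNReal.ofReal_le_ofReal (RCLike.re_le_norm _)

theorem tsum_inner_le_norm_mul_traceNorm (A T : H →L[ℂ] H) :
    ∑' i, ‖⟪basis H i, A (T (basis H i))⟫_ℂ‖ₑ ≤ ‖A‖ₑ * traceNorm T := by
  rcases eq_or_ne A 0 with rfl | hA
  · simp
  have hnorm : (‖A‖ : ℂ) ≠ 0 := by simpa using hA
  have h := tsum_inner_le_traceNorm (norm_smul_inv_norm (𝕜 := ℂ) hA).le ((‖A‖ : ℂ) • T)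
  rw [traceNorm_smul, ← ofReal_norm (‖A‖ : ℂ), Complex.norm_real, norm_norm, ofReal_norm] at h
  simpa only [smul_apply, map_smul, smul_smul, RCLike.ofReal_eq_complex_ofReal,
    mul_inv_cancel₀ hnorm, one_smul] using h

theorem traceNorm_mul_le (A T : H →L[ℂ] H) : traceNorm (A * T) ≤ ‖A‖ₑ * traceNorm T := by
  refine traceNorm_le_of_forall_enorm_sum_inner_le fun V hV s => ?_
  calc ‖∑ i ∈ s, ⟪basis H i, V ((A * T) (basis H i))⟫_ℂ‖ₑ
      ≤ ∑' i, ‖⟪basis H i, (V * A) (T (basis H i))⟫_ℂ‖ₑ :=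
        (enorm_sum_le _ _).trans (ENNReal.sum_le_tsum s)
    _ ≤ ‖V * A‖ₑ * traceNorm T := tsum_inner_le_norm_mul_traceNorm _ _
    _ ≤ ‖A‖ₑ * traceNorm T := by
        gcongr
        rw [enorm_le_iff_norm_le]
        exact (norm_mul_le _ _).trans (mul_le_of_le_one_left (norm_nonneg _) hV)

theorem traceNorm_mul_le_hsNorm_mul (A B : H →L[ℂ] H) :
    traceNorm (A * B) ≤ hsNorm A * hsNorm B := by
  refine traceNorm_le_of_forall_enorm_sum_inner_le fun V hV s => ?_
  have hinner (i) : ⟪basis H i, V ((A * B) (basis H i))⟫_ℂ =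
      ⟪(star (V * A)) (basis H i), B (basis H i)⟫_ℂ :=
    (ContinuousLinearMap.adjoint_inner_left (V * A) _ _).symm
  calc ‖∑ i ∈ s, ⟪basis H i, V ((A * B) (basis H i))⟫_ℂ‖ₑ
      ≤ ∑' i, ‖⟪(star (V * A)) (basis H i), B (basis H i)⟫_ℂ‖ₑ := by
        simp only [hinner]
        exact (enorm_sum_le _ _).trans (ENNReal.sum_le_tsum s)
    _ ≤ hsNorm (V * A) * hsNorm B := hsNorm_star (V * A) ▸ tsum_inner_le_hsNorm_mul _ _
    _ ≤ hsNorm A * hsNorm B := by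
        gcongr
        refine (hsNorm_mul_le V A).trans (mul_le_of_le_one_left zero_le ?_)
        rwa [← ofReal_norm, ENNReal.ofReal_le_one]

theorem IsHilbertSchmidt.isTraceClass_mul {A B : H →L[ℂ] H} (hA : IsHilbertSchmidt A)
    (hB : IsHilbertSchmidt B) : IsTraceClass (A * B) :=
  (traceNorm_mul_le_hsNorm_mul A B).trans_lt (ENNReal.mul_lt_top hA hB)

theorem IsTraceClass.mul_left {T : H →L[ℂ] H} (hT : IsTraceClass T) (A : H →L[ℂ] H) :
    IsTraceClass (A * T) :=
  (traceNorm_mul_le A T).trans_lt (ENNReal.mul_lt_top enorm_lt_top hT)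

theorem IsTraceClass.add {S T : H →L[ℂ] H} (hS : IsTraceClass S) (hT : IsTraceClass T) :
    IsTraceClass (S + T) :=
  (traceNorm_add_le S T).trans_lt (ENNReal.add_lt_top.2 ⟨hS, hT⟩)

theorem IsTraceClass.sub {S T : H →L[ℂ] H} (hS : IsTraceClass S) (hT : IsTraceClass T) :
    IsTraceClass (S - T) :=
  (traceClassSubmodule H).sub_mem hS hT

theorem IsTraceClass.exists_eq_mul {T : H →L[ℂ] H} (hT : IsTraceClass T) :
    ∃ A B : H →L[ℂ] H, IsHilbertSchmidt A ∧ IsHilbertSchmidt B ∧ T = A * B := by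
  obtain ⟨U, -, hU, -⟩ := exists_polar T
  have habs : 0 ≤ CFC.sqrt (star T * T) := CFC.sqrt_nonneg _
  have hroot : IsHilbertSchmidt (CFC.sqrt (CFC.sqrt (star T * T))) := by
    rw [IsHilbertSchmidt, hsNorm_eq (basis H), ← posTrace_eq (basis H) habs]
    exact ENNReal.rpow_lt_top_of_nonneg (by norm_num) hT.ne
  refine ⟨_, _, hroot.mul_left U, hroot, ?_⟩
  rw [mul_assoc, CFC.sqrt_mul_sqrt_self _ habs, ← hU]

/-! ### The trace -/

theorem IsTraceClass.hasSum_trace {T : H →L[ℂ] H} (hT : IsTraceClass T) :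
    HasSum (fun i => ⟪basis H i, T (basis H i)⟫_ℂ) (trace T) := by
  have hle := tsum_inner_le_norm_mul_traceNorm (1 : H →L[ℂ] H) T
  have hfin := (hle.trans_lt (ENNReal.mul_lt_top enorm_lt_top hT)).ne
  exact (Summable.of_norm (by simpa using ENNReal.summable_toReal hfin)).hasSum

theorem enorm_trace_le (T : H →L[ℂ] H) : ‖trace T‖ₑ ≤ traceNorm T :=
  enorm_tsum_le_tsum_enorm.trans
    (tsum_inner_le_traceNorm (V := (1 : H →L[ℂ] H)) ContinuousLinearMap.norm_id_le T)

theorem IsTraceClass.norm_trace_mul_le {T : H →L[ℂ] H} (hT : IsTraceClass T) (A : H →L[ℂ] H) :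
    ‖trace (A * T)‖ ≤ ‖A‖ * (traceNorm T).toReal := by
  have h := ENNReal.toReal_mono (ENNReal.mul_lt_top enorm_lt_top hT).ne
    ((enorm_trace_le (A * T)).trans (traceNorm_mul_le A T))
  rwa [ENNReal.toReal_mul, toReal_enorm, toReal_enorm] at h

theorem IsTraceClass.trace_add {S T : H →L[ℂ] H} (hS : IsTraceClass S) (hT : IsTraceClass T) :
    trace (S + T) = trace S + trace T :=
  HasSum.tsum_eq <| by simpa only [add_apply, inner_add_right] using
    hS.hasSum_trace.add hT.hasSum_trace

theorem IsTraceClass.trace_sub {S T : H →L[ℂ] H} (hS : IsTraceClass S) (hT : IsTraceClass T) :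
    trace (S - T) = trace S - trace T :=
  HasSum.tsum_eq <| by simpa only [sub_apply, inner_sub_right] using
    hS.hasSum_trace.sub hT.hasSum_trace

theorem trace_smul (c : ℂ) (T : H →L[ℂ] H) : trace (c • T) = c * trace T := by
  simp only [trace, smul_apply, inner_smul_right, tsum_mul_left]

theorem IsHilbertSchmidt.summable_norm_inner_sq {A : H →L[ℂ] H} (hA : IsHilbertSchmidt A) :
    Summable fun p : basisSet H × basisSet H => ‖⟪basis H p.2, A (basis H p.1)⟫_ℂ‖ ^ 2 := by
  have hfin : ∑' p : basisSet H × basisSet H, ‖⟪basis H p.2, A (basis H p.1)⟫_ℂ‖ₑ ^ 2 ≠ ∞ := by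
    rw [ENNReal.tsum_prod', ← hsNorm_sq_eq_tsum_tsum]
    exact (ENNReal.pow_lt_top hA).ne
  exact (ENNReal.summable_toReal hfin).congr fun p => by simp

theorem IsHilbertSchmidt.summable_inner_mul_inner {A B : H →L[ℂ] H} (hA : IsHilbertSchmidt A)
    (hB : IsHilbertSchmidt B) : Summable (Function.uncurry fun i j : basisSet H =>
      ⟪basis H i, A (basis H j)⟫_ℂ * ⟪basis H j, B (basis H i)⟫_ℂ) := by
  refine .of_norm_bounded (((Equiv.prodComm _ _).summable_iff.2 hA.summable_norm_inner_sq).add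
    hB.summable_norm_inner_sq) fun p => ?_
  simp only [Function.uncurry, norm_mul, Function.comp_apply,
    Equiv.prodComm_apply, Prod.fst_swap, Prod.snd_swap]
  nlinarith [sq_nonneg (‖⟪basis H p.1, A (basis H p.2)⟫_ℂ‖ - ‖⟪basis H p.2, B (basis H p.1)⟫_ℂ‖),
    sq_nonneg ‖⟪basis H p.1, A (basis H p.2)⟫_ℂ‖, sq_nonneg ‖⟪basis H p.2, B (basis H p.1)⟫_ℂ‖]

theorem trace_mul (A B : H →L[ℂ] H) : trace (A * B) =
    ∑' i, ∑' j, ⟪basis H i, A (basis H j)⟫_ℂ * ⟪basis H j, B (basis H i)⟫_ℂ := by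
  refine tsum_congr fun i => ?_
  rw [mul_apply_eq_comp, ← ContinuousLinearMap.adjoint_inner_left,
    ← (basis H).tsum_inner_mul_inner]
  simp only [ContinuousLinearMap.adjoint_inner_left]

theorem IsHilbertSchmidt.trace_mul_comm {A B : H →L[ℂ] H} (hA : IsHilbertSchmidt A)
    (hB : IsHilbertSchmidt B) : trace (A * B) = trace (B * A) := by
  rw [trace_mul, trace_mul, ← (hA.summable_inner_mul_inner hB).tsum_comm]
  simp only [mul_comm]

/-! ### Rank-one operators -/

theorem rankOne_mul (A : H →L[ℂ] H) (a b : H) : rankOne ℂ a b * A = rankOne ℂ a (star A b) :=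
  rankOne_comp a b A

theorem star_rankOne (a b : H) : star (rankOne ℂ a b) = rankOne ℂ b a := by
  rw [ContinuousLinearMap.star_eq_adjoint, adjoint_rankOne]

theorem hsNorm_rankOne (a b : H) : hsNorm (rankOne ℂ a b) = ‖a‖ₑ * ‖b‖ₑ := by
  have hb : ‖b‖ₑ ^ 2 = ∑' i, ‖⟪b, basis H i⟫_ℂ‖ₑ ^ 2 := by
    simp only [enorm_inner_symm b, ← enorm_sq_eq_tsum]
  refine (ENNReal.pow_right_strictMono two_ne_zero).injective ?_
  simp only [hsNorm_sq (basis H), rankOne_apply, enorm_smul, mul_pow, ENNReal.tsum_mul_right, ← hb,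
    mul_comm (‖a‖ₑ ^ 2)]

theorem isHilbertSchmidt_rankOne (a b : H) : IsHilbertSchmidt (rankOne ℂ a b) := by
  rw [IsHilbertSchmidt, hsNorm_rankOne]
  exact ENNReal.mul_lt_top enorm_lt_top enorm_lt_top

theorem hasSum_trace_rankOne_mul (a b : H) (T : H →L[ℂ] H) :
    HasSum (fun i => ⟪basis H i, (rankOne ℂ a b * T) (basis H i)⟫_ℂ) ⟪b, T a⟫_ℂ := by
  have h := (basis H).hasSum_inner_mul_inner (star T b) a
  rw [ContinuousLinearMap.star_eq_adjoint, ContinuousLinearMap.adjoint_inner_left] at h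
  refine h.congr_fun fun i => ?_
  rw [ContinuousLinearMap.adjoint_inner_left, mul_apply_eq_comp, rankOne_apply, inner_smul_right]

theorem trace_rankOne_mul (a b : H) (T : H →L[ℂ] H) : trace (rankOne ℂ a b * T) = ⟪b, T a⟫_ℂ :=
  (hasSum_trace_rankOne_mul a b T).tsum_eq

end Schatten

section FiniteRank

variable {H : Type*} [NormedAddCommGroup H] [InnerProductSpace ℂ H] {ι : Type*}

/-! ### Finite-rank projections -/

theorem mul_rankOne (A : H →L[ℂ] H) (a b : H) : A * rankOne ℂ a b = rankOne ℂ (A a) b :=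
  comp_rankOne a b A

theorem isCompactOperator_rankOne (a b : H) : IsCompactOperator (rankOne ℂ a b) :=
  (isCompactOperator_of_locallyCompactSpace_dom (innerSL ℂ b)).clm_comp
    (ContinuousLinearMap.toSpanSingleton ℂ a)

/-- The finite-rank operator `∑ |u i⟩⟨u i|`, the orthogonal projection onto the span of the
vectors `u i`, `i ∈ s`, when `u` is orthonormal. -/
def frameProj (s : Finset ι) (u : ι → H) : H →L[ℂ] H :=
  ∑ i ∈ s, rankOne ℂ (u i) (u i)

theorem frameProj_apply (s : Finset ι) (u : ι → H) (x : H) :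
    frameProj s u x = ∑ i ∈ s, ⟪u i, x⟫_ℂ • u i := by
  simp only [frameProj, sum_apply, rankOne_apply]

theorem isCompactOperator_frameProj (s : Finset ι) (u : ι → H) :
    IsCompactOperator (frameProj s u) :=
  (compactOperator (RingHom.id ℂ) H H).sum_mem
    fun i _ => isCompactOperator_rankOne (u i) (u i)

theorem norm_frameProj_apply_sq {u : ι → H} (hu : Orthonormal ℂ u) (s : Finset ι) (x : H) :
    ‖frameProj s u x‖ ^ 2 = ∑ i ∈ s, ‖⟪u i, x⟫_ℂ‖ ^ 2 := by
  have h := hu.inner_sum (fun i => ⟪u i, x⟫_ℂ) (fun i => ⟪u i, x⟫_ℂ) s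
  rw [← frameProj_apply, inner_self_eq_norm_sq_to_K] at h
  simp only [Complex.conj_mul'] at h
  apply Complex.ofReal_injective
  push_cast
  exact h

theorem enorm_frameProj_apply_sq {u : ι → H} (hu : Orthonormal ℂ u) (s : Finset ι)
    (x : H) :
    ‖frameProj s u x‖ₑ ^ 2 = ∑ i ∈ s, ‖⟪u i, x⟫_ℂ‖ₑ ^ 2 := by
  have h := congrArg ENNReal.ofReal (norm_frameProj_apply_sq hu s x)
  rw [ENNReal.ofReal_sum_of_nonneg fun i _ => by positivity] at h
  simpa only [ENNReal.ofReal_pow (norm_nonneg _), ofReal_norm] using h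

theorem norm_frameProj_le {u : ι → H} (hu : Orthonormal ℂ u) (s : Finset ι) :
    ‖frameProj s u‖ ≤ 1 := by
  refine ContinuousLinearMap.opNorm_le_bound _ zero_le_one fun x => ?_
  rw [one_mul, ← sq_le_sq₀ (norm_nonneg _) (norm_nonneg _), norm_frameProj_apply_sq hu]
  exact hu.sum_inner_products_le x

theorem frameProj_eq_self {u : ι → H} (hu : Orthonormal ℂ u) {s : Finset ι} {y : H}
    (hy : y ∈ Submodule.span ℂ (u '' s)) : frameProj s u y = y := by
  induction hy using Submodule.span_induction with
  | mem x hx =>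
    obtain ⟨i, hi, rfl⟩ := hx
    rw [frameProj_apply, Finset.sum_eq_single_of_mem i hi fun j _ hj => by
      rw [hu.2 hj, zero_smul], inner_self_eq_norm_sq_to_K, hu.1]
    simp
  | zero => exact map_zero _
  | add x y _ _ hx hy => rw [map_add, hx, hy]
  | smul c x _ hx => rw [map_smul, hx]

theorem enorm_frameProj_le {u : ι → H} (hu : Orthonormal ℂ u) (s : Finset ι) :
    ‖frameProj s u‖ₑ ≤ 1 := by
  rw [← enorm_one (G := ℝ)]
  exact enorm_le_iff_norm_le.2 (by simpa only [norm_one] using norm_frameProj_le hu s)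

/-- Projections onto the spans of orthonormal families `u n k`, `k ∈ s n`, that converge strongly
to the identity along the filter `l`. -/
structure IsExhausting {α : Type*} (l : Filter α) {ι : α → Type*} (s : ∀ n, Finset (ι n))
    (u : ∀ n, ι n → H) : Prop where
  orthonormal : ∀ n, Orthonormal ℂ (u n)
  tendsto : ∀ x, Tendsto (fun n => frameProj (s n) (u n) x) l (𝓝 x)

theorem isExhausting_of_forall_exists_mem_span {α : Type*} {l : Filter α} {ι : α → Type*}
    {s : ∀ n, Finset (ι n)} {u : ∀ n, ι n → H} (hu : ∀ n, Orthonormal ℂ (u n))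
    (h : ∀ x, ∀ ε > 0, ∀ᶠ n in l, ∃ y ∈ Submodule.span ℂ (u n '' s n), ‖x - y‖ < ε) :
    IsExhausting l s u where
  orthonormal := hu
  tendsto x := by
    refine Metric.tendsto_nhds.2 fun ε hε => ?_
    filter_upwards [h x (ε / 2) (half_pos hε)] with n ⟨y, hy, hxy⟩
    have hP : ‖frameProj (s n) (u n) (x - y)‖ ≤ ‖x - y‖ := by
      simpa only [one_mul] using
        (frameProj (s n) (u n)).le_of_opNorm_le (norm_frameProj_le (hu n) _) (x - y)
    rw [map_sub, frameProj_eq_self (hu n) hy] at hP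
    rw [dist_eq_norm, ← sub_sub_sub_cancel_right _ x y]
    linarith [norm_sub_le (frameProj (s n) (u n) x - y) (x - y)]

theorem tendsto_mul_of_isCompactOperator {α : Type*} {l : Filter α} {D : α → H →L[ℂ] H}
    {D₀ : H →L[ℂ] H} {c : NNReal} (hc : ∀ n, ‖D n‖₊ ≤ c)
    (hD : ∀ x, Tendsto (fun n => D n x) l (𝓝 (D₀ x))) {T : H →L[ℂ] H} (hT : IsCompactOperator T) :
    Tendsto (fun n => D n * T) l (𝓝 (D₀ * T)) := by
  set K := closure (T '' Metric.closedBall 0 1)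
  have hK : IsCompact K := hT.isCompact_closure_image_closedBall (𝕜₁ := ℂ) 1
  have hequi : UniformEquicontinuous fun n => (D n : H → H) :=
    LipschitzWith.uniformEquicontinuous _ c fun n => (D n).lipschitz.weaken (hc n)
  have hunif : TendstoUniformlyOn (fun n x => D n x) D₀ l K := by
    have h := (EquicontinuousOn.tendsto_uniformOnFun_iff_pi' (𝔖 := {K}) (by simpa)
      (fun _ _ => hequi.equicontinuous.equicontinuousOn _) l D₀).2
      (tendsto_pi_nhds.2 fun x => hD x)
    exact UniformOnFun.tendsto_iff_tendstoUniformlyOn.1 h K rfl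
  rw [Metric.tendstoUniformlyOn_iff] at hunif
  refine Metric.tendsto_nhds.2 fun ε hε => ?_
  filter_upwards [hunif (ε / 2) (half_pos hε)] with n hn
  rw [dist_eq_norm]
  refine lt_of_le_of_lt (ContinuousLinearMap.opNorm_le_of_unit_norm (half_pos hε).le
    fun x hx => ?_) (half_lt_self hε)
  have hmem : T x ∈ K := subset_closure ⟨x, by simp [hx], rfl⟩
  rw [sub_apply, mul_apply_eq_comp, mul_apply_eq_comp, ← dist_eq_norm_sub']
  exact (hn (T x) hmem).le

namespace IsExhausting

variable {α : Type*} {l : Filter α} {ι : α → Type*} {s : ∀ n, Finset (ι n)} {u : ∀ n, ι n → H}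

theorem tendsto_apply (h : IsExhausting l s u) {y : α → H} {y₀ : H} (hy : Tendsto y l (𝓝 y₀)) :
    Tendsto (fun n => frameProj (s n) (u n) (y n)) l (𝓝 y₀) := by
  have hdiff : Tendsto (fun n => frameProj (s n) (u n) (y n - y₀)) l (𝓝 0) := by
    refine squeeze_zero_norm (fun n => ?_) (tendsto_iff_norm_sub_tendsto_zero.1 hy)
    simpa only [one_mul] using
      (frameProj (s n) (u n)).le_of_opNorm_le (norm_frameProj_le (h.orthonormal n) _) (y n - y₀)
  simpa only [map_sub, sub_add_cancel, zero_add] using hdiff.add (h.tendsto y₀)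

theorem tendsto_compression_apply (h : IsExhausting l s u) (T : H →L[ℂ] H) (x : H) :
    Tendsto (fun n => (frameProj (s n) (u n) * T * frameProj (s n) (u n)) x) l (𝓝 (T x)) :=
  h.tendsto_apply ((T.continuous.tendsto x).comp (h.tendsto x))

theorem tendsto_mul_of_isCompactOperator (h : IsExhausting l s u) {T : H →L[ℂ] H}
    (hT : IsCompactOperator T) : Tendsto (fun n => frameProj (s n) (u n) * T) l (𝓝 T) := by
  simpa only [one_mul] using ELam.tendsto_mul_of_isCompactOperator (D₀ := 1) (c := 1)
    (fun n => norm_frameProj_le (h.orthonormal n) (s n)) h.tendsto hT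

end IsExhausting

end FiniteRank

section FiniteRank

variable {H : Type*} [NormedAddCommGroup H] [InnerProductSpace ℂ H] [CompleteSpace H] {ι : Type*}

theorem star_frameProj (s : Finset ι) (u : ι → H) : star (frameProj s u) = frameProj s u := by
  simp only [frameProj, star_sum, star_rankOne]

theorem isHilbertSchmidt_frameProj (s : Finset ι) (u : ι → H) :
    IsHilbertSchmidt (frameProj s u) :=
  (hilbertSchmidtSubmodule H).sum_mem fun i _ => isHilbertSchmidt_rankOne (u i) (u i)

theorem frameProj_mul (s : Finset ι) (u : ι → H) (T : H →L[ℂ] H) :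
    frameProj s u * T = ∑ i ∈ s, rankOne ℂ (u i) (star T (u i)) := by
  simp only [frameProj, Finset.sum_mul, rankOne_mul]

theorem trace_frameProj_mul (s : Finset ι) (u : ι → H) (T : H →L[ℂ] H) :
    trace (frameProj s u * T) = ∑ i ∈ s, ⟪u i, T (u i)⟫_ℂ := by
  refine HasSum.tsum_eq ((hasSum_sum fun i (_ : i ∈ s) =>
    hasSum_trace_rankOne_mul (u i) (u i) T).congr_fun fun j => ?_)
  rw [frameProj, Finset.sum_mul, sum_apply, inner_sum]

section Orthonormal

variable {u : ι → H} (hu : Orthonormal ℂ u) (s : Finset ι)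
include hu

theorem hsNorm_mul_frameProj_sq (T : H →L[ℂ] H) :
    hsNorm (T * frameProj s u) ^ 2 = ∑ i ∈ s, ‖T (u i)‖ₑ ^ 2 := by
  rw [← hsNorm_star, star_mul, star_frameProj, hsNorm_sq (basis H)]
  simp only [mul_apply_eq_comp, enorm_frameProj_apply_sq hu]
  rw [Summable.tsum_finsetSum fun i _ => ENNReal.summable]
  refine Finset.sum_congr rfl fun i _ => ?_
  rw [enorm_sq_eq_tsum (basis H)]
  refine tsum_congr fun j => ?_
  rw [ContinuousLinearMap.star_eq_adjoint, ContinuousLinearMap.adjoint_inner_right,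
    enorm_inner_symm]

theorem hsNorm_frameProj_mul_le (T : H →L[ℂ] H) : hsNorm (frameProj s u * T) ≤ hsNorm T :=
  (hsNorm_mul_le _ _).trans (mul_le_of_le_one_left' (enorm_frameProj_le hu s))

theorem hsNorm_mul_frameProj_le (T : H →L[ℂ] H) : hsNorm (T * frameProj s u) ≤ hsNorm T :=
  (hsNorm_mul_le' _ _).trans (mul_le_of_le_one_right' (enorm_frameProj_le hu s))

theorem hsNorm_frameProj_sq : hsNorm (frameProj s u) ^ 2 = s.card := by
  rw [← one_mul (frameProj s u), hsNorm_mul_frameProj_sq hu]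
  simp [← ofReal_norm, hu.norm_eq_one]

theorem hsNorm_compression_sq (T : H →L[ℂ] H) :
    hsNorm (frameProj s u * T * frameProj s u) ^ 2 =
      ∑ l ∈ s, ∑ k ∈ s, ‖⟪u k, T (u l)⟫_ℂ‖ₑ ^ 2 := by
  simp only [hsNorm_mul_frameProj_sq hu, mul_apply_eq_comp, enorm_frameProj_apply_sq hu]

end Orthonormal

theorem isExhausting_basis :
    IsExhausting atTop (fun s : Finset (basisSet H) => s) (fun _ => basis H) where
  orthonormal _ := (basis H).orthonormal
  tendsto x := ((basis H).hasSum_repr x).congr fun s => by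
    simp only [frameProj_apply, HilbertBasis.repr_apply_apply]

theorem isCompactOperator_star {T : H →L[ℂ] H} (hT : IsCompactOperator T) :
    IsCompactOperator (star T : H →L[ℂ] H) := by
  have hlim : Tendsto (fun s : Finset (basisSet H) => star (frameProj s (basis H) * T)) atTop
      (𝓝 (star T)) :=
    (continuous_star.tendsto T).comp (isExhausting_basis.tendsto_mul_of_isCompactOperator hT)
  simp only [star_mul, star_frameProj] at hlim
  exact isCompactOperator_of_tendsto hlim
    (Eventually.of_forall fun s => (isCompactOperator_frameProj s (basis H)).clm_comp (star T))

namespace IsExhausting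

variable {α : Type*} {l : Filter α} {ι : α → Type*} {s : ∀ n, Finset (ι n)} {u : ∀ n, ι n → H}

theorem tendsto_hsNorm_sub_mul (h : IsExhausting l s u) {B : H →L[ℂ] H}
    (hB : IsHilbertSchmidt B) :
    Tendsto (fun n => hsNorm (B - frameProj (s n) (u n) * B)) l (𝓝 0) := by
  have hbound (n : α) : ‖1 - frameProj (s n) (u n)‖ ≤ 1 + 1 :=
    (norm_sub_le _ _).trans
      (add_le_add ContinuousLinearMap.norm_id_le (norm_frameProj_le (h.orthonormal n) _))
  have hlim (x : H) : Tendsto (fun n => (1 - frameProj (s n) (u n)) x) l (𝓝 0) := by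
    simpa using (tendsto_const_nhds (x := x)).sub (h.tendsto x)
  simpa only [sub_mul, one_mul] using tendsto_hsNorm_mul hbound hlim hB

theorem tendsto_trace_mul (h : IsExhausting l s u) {T : H →L[ℂ] H} (hT : IsTraceClass T) :
    Tendsto (fun n => trace (frameProj (s n) (u n) * T)) l (𝓝 (trace T)) := by
  obtain ⟨A, B, hA, hB, rfl⟩ := hT.exists_eq_mul
  have hle (n : α) : edist (trace (A * B)) (trace (frameProj (s n) (u n) * (A * B))) ≤
      hsNorm (A - frameProj (s n) (u n) * A) * hsNorm B := by
    rw [edist_eq_enorm_sub, ← hT.trace_sub (hT.mul_left _), ← mul_assoc, ← sub_mul]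
    exact (enorm_trace_le _).trans (traceNorm_mul_le_hsNorm_mul _ _)
  have hlim := ENNReal.Tendsto.mul_const (h.tendsto_hsNorm_sub_mul hA) (b := hsNorm B)
    (.inr hB.ne)
  rw [zero_mul] at hlim
  rw [tendsto_iff_edist_tendsto_0]
  simp only [edist_comm _ (trace (A * B))]
  exact tendsto_of_tendsto_of_tendsto_of_le_of_le tendsto_const_nhds hlim (fun _ => zero_le) hle

end IsExhausting

end FiniteRank

/-! ### Commutators with approximately diagonal operators -/

section DiagonalApproximation

variable {H : Type*} [NormedAddCommGroup H] [InnerProductSpace ℂ H] [CompleteSpace H]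

theorem inner_lie_of_eigenvectors {S T : H →L[ℂ] H} {a b : ℂ} {x y : H}
    (hx : star S x = star a • x) (hy : S y = b • y) :
    ⟪x, ⁅S, T⁆ y⟫_ℂ = (a - b) * ⟪x, T y⟫_ℂ := by
  rw [ContinuousLinearMap.star_eq_adjoint] at hx
  rw [Ring.lie_def, sub_apply, mul_apply_eq_comp, mul_apply_eq_comp, hy, inner_sub_right,
    ← ContinuousLinearMap.adjoint_inner_left, hx, map_smul, inner_smul_left, inner_smul_right,
    Complex.star_def, Complex.conj_conj, sub_mul]

theorem trace_frameProj_mul_lie {ι : Type*} {s : Finset ι} {u : ι → H} {S : H →L[ℂ] H} {a : ι → ℂ}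
    (hS : ∀ k, S (u k) = a k • u k) (hS' : ∀ k, star S (u k) = star (a k) • u k)
    (T : H →L[ℂ] H) : trace (frameProj s u * ⁅S, T⁆) = 0 := by
  rw [trace_frameProj_mul]
  exact Finset.sum_eq_zero fun k _ => by
    rw [inner_lie_of_eigenvectors (hS' k) (hS k), sub_self, zero_mul]

theorem tendsto_hsNorm_mul_of_isCompactOperator {α : Type*} {l : Filter α} {T : H →L[ℂ] H}
    (hT : IsCompactOperator T) {F : α → H →L[ℂ] H} {C : ℝ≥0∞} (hC : C ≠ ∞)
    (hFC : ∀ n, hsNorm (F n) ≤ C) (hF : Tendsto F l (𝓝 0)) :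
    Tendsto (fun n => hsNorm (T * F n)) l (𝓝 0) := by
  set P := fun t : Finset (basisSet H) => frameProj t (basis H)
  have hle (t : Finset (basisSet H)) (n : α) : hsNorm (T * F n) ≤
      hsNorm (P t * T) * ‖F n‖ₑ + ‖T - P t * T‖ₑ * C := by
    calc hsNorm (T * F n) = hsNorm (P t * T * F n + (T - P t * T) * F n) := by
          rw [← add_mul, add_sub_cancel]
      _ ≤ hsNorm (P t * T * F n) + hsNorm ((T - P t * T) * F n) := hsNorm_add_le _ _
      _ ≤ hsNorm (P t * T) * ‖F n‖ₑ + ‖T - P t * T‖ₑ * C := by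
          gcongr
          · exact hsNorm_mul_le' _ _
          · exact (hsNorm_mul_le _ _).trans (by gcongr; exact hFC n)
  have htail : Tendsto (fun t => ‖T - P t * T‖ₑ * C) atTop (𝓝 0) := by
    have h := (isExhausting_basis.tendsto_mul_of_isCompactOperator hT).const_sub T |>.enorm
    simpa using ENNReal.Tendsto.mul_const h (.inr hC)
  refine ENNReal.tendsto_nhds_zero.2 fun ε hε => ?_
  obtain ⟨t, ht⟩ := (ENNReal.tendsto_nhds_zero.1 htail (ε / 2) (ENNReal.half_pos hε.ne')).exists
  have hPT : hsNorm (P t * T) ≠ ∞ := ((isHilbertSchmidt_frameProj t _).mul_right T).ne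
  have hhead : Tendsto (fun n => hsNorm (P t * T) * ‖F n‖ₑ) l (𝓝 0) := by
    simpa using ENNReal.Tendsto.const_mul hF.enorm (.inr hPT)
  filter_upwards [ENNReal.tendsto_nhds_zero.1 hhead (ε / 2) (ENNReal.half_pos hε.ne')] with n hn
  exact (hle t n).trans ((add_le_add hn ht).trans_eq (ENNReal.add_halves ε))

theorem tendsto_hsNorm_mul_of_isCompactOperator' {α : Type*} {l : Filter α} {T : H →L[ℂ] H}
    (hT : IsCompactOperator T) {F : α → H →L[ℂ] H} {C : ℝ≥0∞} (hC : C ≠ ∞)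
    (hFC : ∀ n, hsNorm (F n) ≤ C) (hF : Tendsto F l (𝓝 0)) :
    Tendsto (fun n => hsNorm (F n * T)) l (𝓝 0) := by
  have h := tendsto_hsNorm_mul_of_isCompactOperator (isCompactOperator_star hT) hC
    (F := fun n => star (F n)) (fun n => (hsNorm_star (F n)).trans_le (hFC n))
    (star_zero (H →L[ℂ] H) ▸ (continuous_star.tendsto 0).comp hF)
  simpa only [← star_mul, hsNorm_star] using h

variable {α : Type*} {l : Filter α} {ι : α → Type*} {s : ∀ n, Finset (ι n)} {u : ∀ n, ι n → H}

theorem hsNorm_compression_lie_le {ι : Type*} {s : Finset ι} {u : ι → H} (hu : Orthonormal ℂ u)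
    {S S' : H →L[ℂ] H} {a b : ι → ℂ}
    (hS : ∀ k, S (u k) = a k • u k ∧ star S (u k) = star (a k) • u k)
    (hS' : ∀ k, S' (u k) = b k • u k ∧ star S' (u k) = star (b k) • u k)
    (hab : ∀ k ∈ s, ∀ l ∈ s, ‖a k - a l‖ ≤ ‖b k - b l‖) (T : H →L[ℂ] H) :
    hsNorm (frameProj s u * ⁅S, T⁆ * frameProj s u) ≤
      hsNorm (frameProj s u * ⁅S', T⁆ * frameProj s u) := by
  rw [hsNorm_le_iff, hsNorm_compression_sq hu, hsNorm_compression_sq hu]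
  refine Finset.sum_le_sum fun l hl => Finset.sum_le_sum fun k hk => ?_
  rw [inner_lie_of_eigenvectors (hS k).2 (hS l).1, inner_lie_of_eigenvectors (hS' k).2 (hS' l).1,
    enorm_mul, enorm_mul]
  gcongr
  exact enorm_le_iff_norm_le.2 (hab k hk l hl)

/-- `M` is approximated in norm by operators `S n` that are diagonal, with eigenvalues `a n k`, on
the vectors `u n k`, at a rate compensating the growth of the Hilbert--Schmidt norms of the
projections onto the spans of `u n k`, `k ∈ s n`. For compact `T` the off-diagonal errors
`⁅M - S n, T⁆` are then negligible in Hilbert--Schmidt norm. -/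
structure DiagonalApproximation (l : Filter α) (s : ∀ n, Finset (ι n)) (u : ∀ n, ι n → H)
    (M : H →L[ℂ] H) (a : ∀ n, ι n → ℂ) (S : α → H →L[ℂ] H) : Prop where
  apply_and_star_apply : ∀ n k,
    S n (u n k) = a n k • u n k ∧ star (S n) (u n k) = star (a n k) • u n k
  tendsto : Tendsto S l (𝓝 M)
  exists_bound : ∃ C ≠ ∞, ∀ n, ‖M - S n‖ₑ * hsNorm (frameProj (s n) (u n)) ≤ C

namespace DiagonalApproximation

variable {M N : H →L[ℂ] H} {a b : ∀ n, ι n → ℂ} {S S' : α → H →L[ℂ] H}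

theorem tendsto_hsNorm_compression_lie (hM : DiagonalApproximation l s u M a S)
    (hu : ∀ n, Orthonormal ℂ (u n)) {T : H →L[ℂ] H} (hT : IsCompactOperator T) :
    Tendsto (fun n => hsNorm (frameProj (s n) (u n) * ⁅M - S n, T⁆ * frameProj (s n) (u n)))
      l (𝓝 0) := by
  obtain ⟨C, hC, hbound⟩ := hM.exists_bound
  set P := fun n => frameProj (s n) (u n)
  set R := fun n => M - S n
  have hP (n : α) : ‖P n‖ ≤ 1 := norm_frameProj_le (hu n) (s n)
  have hR : Tendsto R l (𝓝 0) := by simpa using hM.tendsto.const_sub M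
  have hRP := tendsto_hsNorm_mul_of_isCompactOperator hT hC (F := fun n => R n * P n)
    (fun n => (hsNorm_mul_le _ _).trans (hbound n))
    (squeeze_zero_norm (fun n => (norm_mul_le _ _).trans
      (mul_le_of_le_one_right (norm_nonneg _) (hP n))) (tendsto_zero_iff_norm_tendsto_zero.1 hR))
  have hPR := tendsto_hsNorm_mul_of_isCompactOperator' hT hC (F := fun n => P n * R n)
    (fun n => (hsNorm_mul_le' _ _).trans ((mul_comm _ _).trans_le (hbound n)))
    (squeeze_zero_norm (fun n => (norm_mul_le _ _).trans
      (mul_le_of_le_one_left (norm_nonneg _) (hP n))) (tendsto_zero_iff_norm_tendsto_zero.1 hR))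
  have hsum := hPR.add hRP
  rw [add_zero] at hsum
  refine tendsto_of_tendsto_of_tendsto_of_le_of_le tendsto_const_nhds hsum
    (fun _ => zero_le) fun n => ?_
  calc hsNorm (P n * ⁅R n, T⁆ * P n) = hsNorm (P n * R n * T * P n - P n * (T * (R n * P n))) := by
        rw [Ring.lie_def]; noncomm_ring
    _ ≤ hsNorm (P n * R n * T * P n) + hsNorm (P n * (T * (R n * P n))) := hsNorm_sub_le _ _
    _ ≤ hsNorm (P n * R n * T) + hsNorm (T * (R n * P n)) :=
        add_le_add (hsNorm_mul_frameProj_le (hu n) _ _) (hsNorm_frameProj_mul_le (hu n) _ _)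

theorem hsNorm_lie_le [l.NeBot] (hM : DiagonalApproximation l s u M a S)
    (hN : DiagonalApproximation l s u N b S') (hu : IsExhausting l s u)
    (hab : ∀ n, ∀ j ∈ s n, ∀ k ∈ s n, ‖a n j - a n k‖ ≤ ‖b n j - b n k‖)
    {T : H →L[ℂ] H} (hT : IsCompactOperator T) : hsNorm ⁅M, T⁆ ≤ hsNorm ⁅N, T⁆ := by
  set P := fun n => frameProj (s n) (u n)
  set errM := fun n => hsNorm (P n * ⁅M - S n, T⁆ * P n)
  set errN := fun n => hsNorm (P n * ⁅N - S' n, T⁆ * P n)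
  have hle (n : α) : hsNorm (P n * ⁅M, T⁆ * P n) ≤ hsNorm ⁅N, T⁆ + errN n + errM n := by
    calc hsNorm (P n * ⁅M, T⁆ * P n)
        = hsNorm (P n * ⁅S n, T⁆ * P n + P n * ⁅M - S n, T⁆ * P n) := by
          simp only [Ring.lie_def]; noncomm_ring
      _ ≤ hsNorm (P n * ⁅S n, T⁆ * P n) + errM n := hsNorm_add_le _ _
      _ ≤ hsNorm (P n * ⁅S' n, T⁆ * P n) + errM n := by
          gcongr
          exact hsNorm_compression_lie_le (hu.orthonormal n) (hM.apply_and_star_apply n)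
            (hN.apply_and_star_apply n) (hab n) T
      _ = hsNorm (P n * ⁅N, T⁆ * P n - P n * ⁅N - S' n, T⁆ * P n) + errM n := by
          simp only [Ring.lie_def]; noncomm_ring
      _ ≤ hsNorm (P n * ⁅N, T⁆ * P n) + errN n + errM n := by
          gcongr
          exact hsNorm_sub_le _ _
      _ ≤ hsNorm ⁅N, T⁆ + errN n + errM n := by
          gcongr
          exact (hsNorm_mul_frameProj_le (hu.orthonormal n) _ _).trans
            (hsNorm_frameProj_mul_le (hu.orthonormal n) _ _)
  have hlim := ((tendsto_const_nhds (x := hsNorm ⁅N, T⁆)).add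
    (hN.tendsto_hsNorm_compression_lie hu.orthonormal hT)).add
      (hM.tendsto_hsNorm_compression_lie hu.orthonormal hT)
  rw [add_zero, add_zero] at hlim
  exact hsNorm_le_of_tendsto (hu.tendsto_compression_apply _) hle hlim

theorem enorm_trace_frameProj_mul_lie_le (hM : DiagonalApproximation l s u M a S)
    {X : H →L[ℂ] H} (hX : IsHilbertSchmidt X) (n : α) :
    ‖trace (frameProj (s n) (u n) * ⁅M, X⁆)‖ₑ ≤
      2 * (‖M - S n‖ₑ * hsNorm (frameProj (s n) (u n))) * hsNorm X := by
  set P := frameProj (s n) (u n)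
  set R := M - S n
  have hP : IsHilbertSchmidt P := isHilbertSchmidt_frameProj _ _
  have htrace : trace (P * ⁅M, X⁆) = trace (P * R * X) - trace (X * (R * P)) := by
    calc trace (P * ⁅M, X⁆) = trace (P * ⁅S n, X⁆ + (P * R * X - P * (X * R))) := by
          simp only [Ring.lie_def, R]; noncomm_ring
      _ = trace (P * ⁅S n, X⁆) + (trace (P * R * X) - trace (P * (X * R))) := by
          have h₁ : IsTraceClass (P * R * X) := (hP.mul_right R).isTraceClass_mul hX
          have h₂ : IsTraceClass (P * (X * R)) := hP.isTraceClass_mul (hX.mul_right R)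
          have h₃ : IsTraceClass (P * ⁅S n, X⁆) :=
            hP.isTraceClass_mul ((hX.mul_left _).sub (hX.mul_right _))
          rw [h₃.trace_add (h₁.sub h₂), h₁.trace_sub h₂]
      _ = trace (P * R * X) - trace (X * (R * P)) := by
          rw [trace_frameProj_mul_lie (fun k => (hM.apply_and_star_apply n k).1)
            (fun k => (hM.apply_and_star_apply n k).2), zero_add,
            hP.trace_mul_comm (hX.mul_right R), mul_assoc X]
  rw [htrace]
  calc ‖trace (P * R * X) - trace (X * (R * P))‖ₑ
      ≤ ‖trace (P * R * X)‖ₑ + ‖trace (X * (R * P))‖ₑ := enorm_sub_le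
    _ ≤ hsNorm (P * R) * hsNorm X + hsNorm X * hsNorm (R * P) :=
        add_le_add ((enorm_trace_le _).trans (traceNorm_mul_le_hsNorm_mul _ _))
          ((enorm_trace_le _).trans (traceNorm_mul_le_hsNorm_mul _ _))
    _ ≤ hsNorm P * ‖R‖ₑ * hsNorm X + hsNorm X * (‖R‖ₑ * hsNorm P) := by
        gcongr
        · exact hsNorm_mul_le' _ _
        · exact hsNorm_mul_le _ _
    _ = 2 * (‖R‖ₑ * hsNorm P) * hsNorm X := by ring

theorem exists_enorm_trace_lie_le [l.NeBot] (hM : DiagonalApproximation l s u M a S)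
    (hu : IsExhausting l s u) : ∃ C ≠ ∞, ∀ X : H →L[ℂ] H, IsHilbertSchmidt X →
      IsTraceClass ⁅M, X⁆ → ‖trace ⁅M, X⁆‖ₑ ≤ C * hsNorm X := by
  obtain ⟨C, hC, hbound⟩ := hM.exists_bound
  refine ⟨2 * C, ENNReal.mul_ne_top ENNReal.ofNat_ne_top hC, fun X hX hMX => ?_⟩
  refine le_of_tendsto (hu.tendsto_trace_mul hMX).enorm (Eventually.of_forall fun n => ?_)
  refine (hM.enorm_trace_frameProj_mul_lie_le hX n).trans ?_
  gcongr
  exact hbound n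

theorem trace_lie_eq_zero [l.NeBot] (hM : DiagonalApproximation l s u M a S)
    (hu : IsExhausting l s u) {X : H →L[ℂ] H} (hX : IsHilbertSchmidt X)
    (hMX : IsTraceClass ⁅M, X⁆) : trace ⁅M, X⁆ = 0 := by
  obtain ⟨C, hC, hle⟩ := hM.exists_enorm_trace_lie_le hu
  set P := fun n => frameProj (s n) (u n)
  have hP (n : α) : IsHilbertSchmidt (P n) := isHilbertSchmidt_frameProj _ _
  have h₁ (n : α) : IsTraceClass (M * P n * X) := ((hP n).mul_left M).isTraceClass_mul hX
  have h₂ (n : α) : IsTraceClass (P n * (X * M)) := (hP n).isTraceClass_mul (hX.mul_right M)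
  have hlie (n : α) : ⁅M, P n * X⁆ = M * P n * X - P n * (X * M) := by
    rw [Ring.lie_def, mul_assoc, mul_assoc]
  have hzero (n : α) : trace ⁅M, P n * X⁆ = 0 := by
    rw [hlie, (h₁ n).trace_sub (h₂ n), ((hP n).mul_left M).trace_mul_comm hX,
      (hP n).trace_mul_comm (hX.mul_right M), mul_assoc X, sub_self]
  have htail (n : α) : ‖trace ⁅M, X⁆‖ₑ ≤ C * hsNorm (X - P n * X) := by
    have hPX : IsTraceClass ⁅M, P n * X⁆ := hlie n ▸ (h₁ n).sub (h₂ n)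
    have hsub : ⁅M, X - P n * X⁆ = ⁅M, X⁆ - ⁅M, P n * X⁆ := by
      simp only [Ring.lie_def]; noncomm_ring
    have h := hle (X - P n * X) (hX.sub (hX.mul_left _)) (hsub ▸ hMX.sub hPX)
    rwa [hsub, hMX.trace_sub hPX, hzero, sub_zero] at h
  have hlim := ENNReal.Tendsto.const_mul (hu.tendsto_hsNorm_sub_mul hX) (.inr hC)
  rw [mul_zero] at hlim
  exact enorm_eq_zero.1 (le_antisymm (ge_of_tendsto' hlim htail) zero_le)

end DiagonalApproximation

end DiagonalApproximation

section Grid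

variable {Ω : Set ℂ}

/-! ### Multiplication operators -/

theorem mulOp_coeFn (g : Lp ℂ ∞ (leb Ω)) (v : L2 Ω) :
    mulOp g v =ᵐ[leb Ω] fun x => g x * v x :=
  ContinuousLinearMap.coeFn_holder (ContinuousLinearMap.mul ℂ ℂ) g v

theorem star_mulOp (g : Lp ℂ ∞ (leb Ω)) : star (mulOp g) = mulOp (star g) := by
  rw [ContinuousLinearMap.star_eq_adjoint, eq_comm, ContinuousLinearMap.eq_adjoint_iff]
  intro v w
  rw [L2.inner_def, L2.inner_def]
  refine integral_congr_ae ?_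
  filter_upwards [mulOp_coeFn (star g) v, mulOp_coeFn g w, Lp.coeFn_star g] with x hv hw hg
  simp only [hv, hw, hg, RCLike.inner_apply, Pi.star_apply, RCLike.star_def, map_mul,
    RCLike.conj_conj]
  ring

theorem norm_mulOp_sub_le (f g : Lp ℂ ∞ (leb Ω)) : ‖mulOp f - mulOp g‖ ≤ ‖f - g‖ := by
  have hop : ‖(ContinuousLinearMap.mul ℂ ℂ).holderL (leb Ω) ∞ 2 2‖ ≤ 1 :=
    (ContinuousLinearMap.norm_holderL_le _).trans (ContinuousLinearMap.opNorm_mul_le ℂ ℂ)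
  rw [mulOp, mulOp, ← map_sub]
  simpa only [one_mul] using ContinuousLinearMap.le_of_opNorm_le _ hop (f - g)

theorem mulOp_apply_eq_smul {g : Lp ℂ ∞ (leb Ω)} {v : L2 Ω} {c : ℂ}
    (h : ∀ᵐ x ∂(leb Ω), v x ≠ 0 → g x = c) : mulOp g v = c • v := by
  refine Lp.ext ?_
  filter_upwards [h, mulOp_coeFn g v, Lp.coeFn_smul c v] with x hx hgv hcv
  rw [hgv, hcv, Pi.smul_apply, smul_eq_mul]
  by_cases hv : v x = 0
  · rw [hv, mul_zero, mul_zero]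
  · rw [hx hv]

/-! ### The grid -/

/-- The half-open square of the grid of mesh `1 / (n + 1)` with lower left corner
`k / (n + 1)`. -/
def cell (n : ℕ) (k : ℤ × ℤ) : Set ℂ :=
  {z | ⌊(n + 1) * z.re⌋ = k.1 ∧ ⌊(n + 1) * z.im⌋ = k.2}

theorem measurableSet_cell (n : ℕ) (k : ℤ × ℤ) : MeasurableSet (cell n k) :=
  .inter (Int.measurable_floor.comp (Complex.measurable_re.const_mul _)
      (measurableSet_singleton k.1))
    (Int.measurable_floor.comp (Complex.measurable_im.const_mul _) (measurableSet_singleton k.2))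

theorem disjoint_cell (n : ℕ) {k l : ℤ × ℤ} (h : k ≠ l) : Disjoint (cell n k) (cell n l) :=
  Set.disjoint_left.2 fun _ hk hl =>
    h (Prod.ext (hk.1.symm.trans hl.1) (hk.2.symm.trans hl.2))

theorem dist_le_of_mem_cell {n : ℕ} {k : ℤ × ℤ} {z w : ℂ} (hz : z ∈ cell n k)
    (hw : w ∈ cell n k) : dist z w ≤ 2 / (n + 1) := by
  have hn : (0 : ℝ) < n + 1 := by positivity
  have habs {x y : ℝ} (h : ⌊(n + 1) * x⌋ = ⌊(n + 1) * y⌋) : |x - y| ≤ 1 / (n + 1) := by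
    have := (Int.abs_sub_lt_one_of_floor_eq_floor h).le
    rw [← mul_sub, abs_mul, abs_of_pos hn] at this
    rwa [le_div_iff₀' hn]
  calc dist z w ≤ |(z - w).re| + |(z - w).im| :=
        (dist_eq_norm z w).trans_le (Complex.norm_le_abs_re_add_abs_im _)
    _ ≤ 1 / (n + 1) + 1 / (n + 1) := by
        rw [Complex.sub_re, Complex.sub_im]
        exact add_le_add (habs (hz.1.trans hw.1.symm)) (habs (hz.2.trans hw.2.symm))
    _ = 2 / (n + 1) := by ring

/-- The indices of the grid squares that meet `Ω` in positive measure. -/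
abbrev CellIdx (Ω : Set ℂ) (n : ℕ) : Type := {k : ℤ × ℤ // leb Ω (cell n k) ≠ 0}

theorem exists_mem_cell_inter {n : ℕ} (k : CellIdx Ω n) {G : Set ℂ}
    (hG : ∀ᵐ x ∂(leb Ω), x ∈ G) : (cell n k.1 ∩ G).Nonempty :=
  ((frequently_ae_mem_iff.2 k.2).and_eventually hG).exists

theorem ae_exists_mem_cell (n : ℕ) : ∀ᵐ x ∂(leb Ω), ∃ k : CellIdx Ω n, x ∈ cell n k.1 := by
  have hnull : ∀ᵐ x ∂(leb Ω), ∀ k : ℤ × ℤ, leb Ω (cell n k) = 0 → x ∉ cell n k :=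
    ae_all_iff.2 fun k => eventually_imp_distrib_left.2 measure_eq_zero_iff_ae_notMem.1
  filter_upwards [hnull] with x hx
  exact ⟨⟨(⌊(n + 1) * x.re⌋, ⌊(n + 1) * x.im⌋), fun h => hx _ h ⟨rfl, rfl⟩⟩, rfl, rfl⟩

theorem exists_cellIdx_mem_Icc (hm : MeasurableSet Ω) (hb : Bornology.IsBounded Ω) :
    ∃ R : ℕ, ∀ n : ℕ, ∀ k : CellIdx Ω n, k.1 ∈
      Finset.Icc (-((n + 1) * R : ℤ), -((n + 1) * R : ℤ)) ((n + 1) * R, (n + 1) * R) := by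
  obtain ⟨C, hC⟩ := hb.exists_norm_le
  obtain ⟨R, hR⟩ := exists_nat_ge C
  refine ⟨R, fun n k => ?_⟩
  obtain ⟨z, hz, hzΩ⟩ := exists_mem_cell_inter k (ae_restrict_mem hm)
  have hfloor {x : ℝ} (hx : |x| ≤ ‖z‖) :
      -((n + 1) * R : ℤ) ≤ ⌊(n + 1) * x⌋ ∧ ⌊(n + 1) * x⌋ ≤ (n + 1) * R := by
    obtain ⟨hle, hge⟩ := abs_le.1 (hx.trans ((hC z hzΩ).trans hR))
    rw [Int.le_floor, ← Int.cast_le (R := ℝ)]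
    push_cast
    refine ⟨?_, (Int.floor_le _).trans (by gcongr)⟩
    rw [← mul_neg]
    gcongr
  have hre := hfloor (Complex.abs_re_le_norm z)
  have him := hfloor (Complex.abs_im_le_norm z)
  rw [hz.1] at hre
  rw [hz.2] at him
  exact Finset.mem_Icc.2 ⟨⟨hre.1, him.1⟩, hre.2, him.2⟩

theorem finite_cellIdx (hm : MeasurableSet Ω) (hb : Bornology.IsBounded Ω) (n : ℕ) :
    Finite (CellIdx Ω n) := by
  obtain ⟨R, hR⟩ := exists_cellIdx_mem_Icc hm hb
  exact Set.Finite.subset (Finset.finite_toSet _) fun k hk => hR n ⟨k, hk⟩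

/-- The finite set of all indices of grid squares that meet `Ω` in positive measure. -/
def cells (hm : MeasurableSet Ω) (hb : Bornology.IsBounded Ω) (n : ℕ) : Finset (CellIdx Ω n) :=
  have := finite_cellIdx hm hb n
  (Set.toFinite Set.univ).toFinset

theorem mem_cells (hm : MeasurableSet Ω) (hb : Bornology.IsBounded Ω) (n : ℕ)
    (k : CellIdx Ω n) : k ∈ cells hm hb n :=
  (Set.Finite.mem_toFinset _).2 (Set.mem_univ k)

theorem exists_card_cells_le (hm : MeasurableSet Ω) (hb : Bornology.IsBounded Ω) :
    ∃ R : ℕ, ∀ n : ℕ, (cells hm hb n).card ≤ (R * (n + 1)) ^ 2 := by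
  obtain ⟨R, hR⟩ := exists_cellIdx_mem_Icc hm hb
  refine ⟨2 * R + 1, fun n => ?_⟩
  have hcard := Finset.card_le_card_of_injOn (s := cells hm hb n) (fun k => k.1)
    (fun k _ => hR n k) Subtype.val_injective.injOn
  have hside : ((n + 1) * R + 1 - -((n + 1) * R : ℤ)).toNat = 2 * ((n + 1) * R) + 1 := by
    rw [← Int.toNat_natCast (2 * ((n + 1) * R) + 1)]
    congr 1
    push_cast
    ring
  rw [Finset.card_Icc_prod, Int.card_Icc, hside, ← sq] at hcard
  refine hcard.trans (Nat.pow_le_pow_left ?_ 2)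
  nlinarith

theorem isFiniteMeasure_leb (hb : Bornology.IsBounded Ω) : IsFiniteMeasure (leb Ω) :=
  ⟨(Measure.restrict_apply_univ Ω).trans_lt hb.measure_lt_top⟩

theorem leb_ne_top (hb : Bornology.IsBounded Ω) (A : Set ℂ) : leb Ω A ≠ ∞ :=
  have := isFiniteMeasure_leb hb
  measure_ne_top _ A

/-- The indicator function of a grid square, as an element of `L^p`. -/
def cellInd (hb : Bornology.IsBounded Ω) (p : ℝ≥0∞) (n : ℕ) (k : CellIdx Ω n) :
    Lp ℂ p (leb Ω) :=
  indicatorConstLp p (measurableSet_cell n k.1) (leb_ne_top hb _) 1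

theorem cellInd_coeFn (hb : Bornology.IsBounded Ω) (p : ℝ≥0∞) (n : ℕ) (k : CellIdx Ω n) :
    cellInd hb p n k =ᵐ[leb Ω] (cell n k.1).indicator fun _ => 1 :=
  indicatorConstLp_coeFn

theorem cellInd_two_ne_zero (hb : Bornology.IsBounded Ω) (n : ℕ) (k : CellIdx Ω n) :
    cellInd hb 2 n k ≠ 0 := by
  have hpos : 0 < (leb Ω).real (cell n k.1) := ENNReal.toReal_pos k.2 (leb_ne_top hb _)
  rw [← norm_ne_zero_iff, cellInd, norm_indicatorConstLp two_ne_zero ENNReal.ofNat_ne_top,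
    norm_one, one_mul]
  positivity

/-- The indicator function of a grid square, normalized in `L²`. -/
def cellVec (hb : Bornology.IsBounded Ω) (n : ℕ) (k : CellIdx Ω n) : L2 Ω :=
  (‖cellInd hb 2 n k‖ : ℂ)⁻¹ • cellInd hb 2 n k

theorem orthonormal_cellVec (hb : Bornology.IsBounded Ω) (n : ℕ) :
    Orthonormal ℂ (cellVec hb n) := by
  have := isFiniteMeasure_leb hb
  refine ⟨fun k => norm_smul_inv_norm (cellInd_two_ne_zero hb n k), fun k l h => ?_⟩
  have hdisj : cell n k.1 ∩ cell n l.1 = ∅ :=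
    (disjoint_cell n fun e => h (Subtype.ext e)).inter_eq
  change ⟪cellVec hb n k, cellVec hb n l⟫_ℂ = 0
  rw [cellVec, cellVec, inner_smul_left, inner_smul_right, cellInd, cellInd,
    L2.inner_indicatorConstLp_indicatorConstLp, hdisj, measureReal_empty, zero_smul, mul_zero,
    mul_zero]

theorem ae_mem_cell_of_cellVec_ne_zero (hb : Bornology.IsBounded Ω) (n : ℕ)
    (k : CellIdx Ω n) : ∀ᵐ x ∂(leb Ω), cellVec hb n k x ≠ 0 → x ∈ cell n k.1 := by
  filter_upwards [Lp.coeFn_smul (‖cellInd hb 2 n k‖ : ℂ)⁻¹ (cellInd hb 2 n k),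
    cellInd_coeFn hb 2 n k] with x hsmul hind hx
  by_contra hxk
  refine hx (hsmul.trans ?_)
  rw [Pi.smul_apply, hind, Set.indicator_of_notMem hxk, smul_zero]

/-- The step function with value `c k` on the grid square with index `k`. -/
def stepLp (hm : MeasurableSet Ω) (hb : Bornology.IsBounded Ω) (p : ℝ≥0∞) (n : ℕ)
    (c : CellIdx Ω n → ℂ) : Lp ℂ p (leb Ω) :=
  ∑ k ∈ cells hm hb n, c k • cellInd hb p n k

theorem ae_stepLp_eq (hm : MeasurableSet Ω) (hb : Bornology.IsBounded Ω) (p : ℝ≥0∞) (n : ℕ)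
    (c : CellIdx Ω n → ℂ) : ∀ᵐ x ∂(leb Ω), ∀ k : CellIdx Ω n, x ∈ cell n k.1 →
      stepLp hm hb p n c x = c k := by
  have hind : ∀ᵐ x ∂(leb Ω), ∀ l : CellIdx Ω n, (c l • cellInd hb p n l : Lp ℂ p (leb Ω)) x =
      c l • (cell n l.1).indicator (fun _ => (1 : ℂ)) x := by
    refine ae_all_iff.2 fun l => ?_
    filter_upwards [Lp.coeFn_smul (c l) (cellInd hb p n l), cellInd_coeFn hb p n l]
      with x hsmul hx
    rw [hsmul, Pi.smul_apply, hx]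
  filter_upwards [hind, Lp.coeFn_finsetSum (cells hm hb n) fun l => c l • cellInd hb p n l]
    with x hx hsum k hk
  rw [stepLp, hsum, Finset.sum_apply, Finset.sum_eq_single_of_mem k (mem_cells hm hb n k), hx,
    Set.indicator_of_mem hk, smul_eq_mul, mul_one]
  intro l _ hl
  rw [hx, Set.indicator_of_notMem, smul_zero]
  exact Set.disjoint_left.1 (disjoint_cell n fun e => hl (Subtype.ext e.symm)) hk

theorem stepLp_two_mem_span (hm : MeasurableSet Ω) (hb : Bornology.IsBounded Ω) (n : ℕ)
    (c : CellIdx Ω n → ℂ) :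
    stepLp hm hb 2 n c ∈ Submodule.span ℂ (cellVec hb n '' cells hm hb n) := by
  refine Submodule.sum_mem _ fun k hk => Submodule.smul_mem _ _ ?_
  have hvec : cellInd hb 2 n k = (‖cellInd hb 2 n k‖ : ℂ) • cellVec hb n k := by
    rw [cellVec, smul_inv_smul₀ (by simpa using cellInd_two_ne_zero hb n k)]
  rw [hvec]
  exact Submodule.smul_mem _ _ (Submodule.subset_span ⟨k, hk, rfl⟩)

theorem norm_sub_stepLp_le (hm : MeasurableSet Ω) (hb : Bornology.IsBounded Ω) {p : ℝ≥0∞}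
    {n : ℕ} {c : CellIdx Ω n → ℂ} {g : Lp ℂ p (leb Ω)} {δ : ℝ} (hδ : 0 ≤ δ)
    (h : ∀ᵐ x ∂(leb Ω), ∀ k : CellIdx Ω n, x ∈ cell n k.1 → ‖g x - c k‖ ≤ δ) :
    ‖g - stepLp hm hb p n c‖ ≤ (leb Ω).real Set.univ ^ p.toReal⁻¹ * δ := by
  have := isFiniteMeasure_leb hb
  refine Lp.norm_le_of_ae_bound hδ ?_
  filter_upwards [h, Lp.coeFn_sub g (stepLp hm hb p n c), ae_exists_mem_cell n,
    ae_stepLp_eq hm hb p n c] with x hx hsub ⟨k, hk⟩ hstep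
  rw [hsub, Pi.sub_apply, hstep k hk]
  exact hx k hk

theorem tendsto_two_div_add_one : Tendsto (fun n : ℕ => (2 : ℝ) / (n + 1)) atTop (𝓝 0) := by
  simpa only [mul_one_div, mul_zero] using
    (tendsto_one_div_add_atTop_nhds_zero_nat (𝕜 := ℝ)).const_mul 2

theorem tendsto_stepLp (hm : MeasurableSet Ω) (hb : Bornology.IsBounded Ω) {p : ℝ≥0∞}
    [Fact (1 ≤ p)] {h : ℂ → ℂ} (hmem : MemLp h p (leb Ω)) (hunif : UniformContinuous h)
    {z : ∀ n, CellIdx Ω n → ℂ} (hz : ∀ n k, z n k ∈ cell n k.1) :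
    Tendsto (fun n => stepLp hm hb p n fun k => h (z n k)) atTop (𝓝 (hmem.toLp h)) := by
  refine Metric.tendsto_nhds.2 fun ε hε => ?_
  obtain ⟨η, hη, hηε⟩ := exists_pos_mul_lt hε ((leb Ω).real Set.univ ^ p.toReal⁻¹)
  obtain ⟨δ, hδ, hδη⟩ := Metric.uniformContinuous_iff.1 hunif η hη
  filter_upwards [tendsto_two_div_add_one.eventually_lt_const hδ] with n hn
  rw [dist_comm, dist_eq_norm]
  refine (norm_sub_stepLp_le hm hb hη.le ?_).trans_lt hηε
  filter_upwards [hmem.coeFn_toLp] with x hx k hk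
  rw [hx, ← dist_eq_norm]
  exact (hδη ((dist_le_of_mem_cell hk (hz n k)).trans_lt hn)).le

theorem isExhausting_cellVec (hm : MeasurableSet Ω) (hb : Bornology.IsBounded Ω) :
    IsExhausting atTop (cells hm hb) (cellVec hb) := by
  have := isFiniteMeasure_leb hb
  refine isExhausting_of_forall_exists_mem_span (orthonormal_cellVec hb) fun v ε hε => ?_
  obtain ⟨h, hcs, hvh, hcont, hmem⟩ := (Lp.memLp v).exists_hasCompactSupport_eLpNorm_sub_le
    ENNReal.ofNat_ne_top (ENNReal.ofReal_pos.2 (half_pos hε)).ne'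
  have hvw : dist v (hmem.toLp h) ≤ ε / 2 := by
    rw [← Lp.toLp_coeFn v (Lp.memLp v), Lp.dist_def]
    refine ENNReal.toReal_le_of_le_ofReal (half_pos hε).le (le_of_eq_of_le ?_ hvh)
    exact eLpNorm_congr_ae ((Lp.memLp v).coeFn_toLp.sub hmem.coeFn_toLp)
  choose z hz using fun n (k : CellIdx Ω n) => nonempty_of_measure_ne_zero k.2
  have hlim := tendsto_stepLp hm hb hmem (hcs.uniformContinuous_of_continuous hcont) hz
  filter_upwards [Metric.tendsto_nhds.1 hlim (ε / 2) (half_pos hε)] with n hn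
  refine ⟨_, stepLp_two_mem_span hm hb n fun k => h (z n k), ?_⟩
  rw [dist_comm] at hn
  rw [← dist_eq_norm]
  linarith [dist_triangle v (hmem.toLp h) (stepLp hm hb 2 n fun k => h (z n k))]

theorem mulOp_stepLp_cellVec (hm : MeasurableSet Ω) (hb : Bornology.IsBounded Ω) (n : ℕ)
    (c : CellIdx Ω n → ℂ) (k : CellIdx Ω n) :
    mulOp (stepLp hm hb ∞ n c) (cellVec hb n k) = c k • cellVec hb n k := by
  refine mulOp_apply_eq_smul ?_
  filter_upwards [ae_mem_cell_of_cellVec_ne_zero hb n k, ae_stepLp_eq hm hb ∞ n c]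
    with x hx hstep hne
  exact hstep k (hx hne)

theorem star_mulOp_stepLp_cellVec (hm : MeasurableSet Ω) (hb : Bornology.IsBounded Ω) (n : ℕ)
    (c : CellIdx Ω n → ℂ) (k : CellIdx Ω n) :
    star (mulOp (stepLp hm hb ∞ n c)) (cellVec hb n k) = star (c k) • cellVec hb n k := by
  rw [star_mulOp]
  refine mulOp_apply_eq_smul ?_
  filter_upwards [ae_mem_cell_of_cellVec_ne_zero hb n k, ae_stepLp_eq hm hb ∞ n c,
    Lp.coeFn_star (stepLp hm hb ∞ n c)] with x hx hstep hstar hne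
  rw [hstar, Pi.star_apply, hstep k (hx hne)]

theorem exists_hsNorm_frameProj_cellVec_le (hm : MeasurableSet Ω) (hb : Bornology.IsBounded Ω) :
    ∃ R : ℕ, ∀ n : ℕ,
      hsNorm (frameProj (cells hm hb n) (cellVec hb n)) ≤ ENNReal.ofReal (R * (n + 1)) := by
  obtain ⟨R, hR⟩ := exists_card_cells_le hm hb
  refine ⟨R, fun n => ?_⟩
  rw [hsNorm_le_iff, hsNorm_frameProj_sq (orthonormal_cellVec hb n),
    ← ENNReal.ofReal_pow (by positivity), ← ENNReal.ofReal_natCast]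
  exact ENNReal.ofReal_le_ofReal (by exact_mod_cast hR n)

theorem diagonalApproximation_mulOp (hm : MeasurableSet Ω) (hb : Bornology.IsBounded Ω)
    {f : Lp ℂ ∞ (leb Ω)} {K : ℝ≥0} {G : Set ℂ} (hG : ∀ᵐ x ∂(leb Ω), x ∈ G)
    (hf : LipschitzOnWith K f G) {z : ∀ n, CellIdx Ω n → ℂ}
    (hz : ∀ n k, z n k ∈ cell n k.1 ∩ G) :
    DiagonalApproximation atTop (cells hm hb) (cellVec hb) (mulOp f) (fun n k => f (z n k))
      (fun n => mulOp (stepLp hm hb ∞ n fun k => f (z n k))) := by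
  have hdist (n : ℕ) : ‖mulOp f - mulOp (stepLp hm hb ∞ n fun k => f (z n k))‖ ≤
      K * (2 / (n + 1)) := by
    refine (norm_mulOp_sub_le _ _).trans
      ((norm_sub_stepLp_le hm hb (δ := K * (2 / (n + 1))) (by positivity) ?_).trans_eq ?_)
    · filter_upwards [hG] with x hx k hk
      rw [← dist_eq_norm]
      exact (hf.dist_le_mul x hx _ (hz n k).2).trans
        (by gcongr; exact dist_le_of_mem_cell hk (hz n k).1)
    · rw [ENNReal.toReal_top, inv_zero, Real.rpow_zero, one_mul]
  refine ⟨fun n k => ⟨mulOp_stepLp_cellVec hm hb n _ k, star_mulOp_stepLp_cellVec hm hb n _ k⟩,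
    ?_, ?_⟩
  · refine tendsto_iff_norm_sub_tendsto_zero.2 (squeeze_zero (fun _ => norm_nonneg _)
      (fun n => (norm_sub_rev _ _).trans_le (hdist n)) ?_)
    simpa only [mul_zero] using tendsto_two_div_add_one.const_mul (K : ℝ)
  · obtain ⟨R, hR⟩ := exists_hsNorm_frameProj_cellVec_le hm hb
    refine ⟨ENNReal.ofReal (2 * K * R), ENNReal.ofReal_ne_top, fun n => ?_⟩
    rw [← ofReal_norm]
    refine (mul_le_mul' (ENNReal.ofReal_le_ofReal (hdist n)) (hR n)).trans_eq ?_
    rw [← ENNReal.ofReal_mul (by positivity)]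
    congr 1
    field_simp

/-! ### The Lipschitz seminorm -/

theorem exists_lipschitzOnWith_of_ae_prod {X Y : Type*} [PseudoMetricSpace X]
    [MeasurableSpace X] [HereditarilyLindelofSpace X] [PseudoMetricSpace Y] {f : X → Y} {K : ℝ≥0}
    {μ : Measure X} [SFinite μ]
    (hf : ∀ᵐ p ∂(μ.prod μ), dist (f p.1) (f p.2) ≤ K * dist p.1 p.2) :
    ∃ G : Set X, (∀ᵐ x ∂μ, x ∈ G) ∧ LipschitzOnWith K f G := by
  refine ⟨{s | (∀ᵐ t ∂μ, dist (f s) (f t) ≤ K * dist s t) ∧ s ∈ μ.support}, ?_,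
    LipschitzOnWith.of_dist_le_mul ?_⟩
  · filter_upwards [Measure.ae_ae_of_ae_prod hf, Measure.support_mem_ae] with s hs hs'
    exact ⟨hs, hs'⟩
  rintro s ⟨hs, hsupp⟩ t ⟨ht, -⟩
  have hfreq : ∃ᶠ r in 𝓝 s, dist (f s) (f t) ≤ K * dist s r + K * dist t r := by
    refine frequently_iff.2 fun {U} hU => ?_
    have hpos := (Measure.mem_support_iff_forall s).1 hsupp U hU
    obtain ⟨r, hrU, hsr, htr⟩ :=
      ((frequently_ae_mem_iff.2 hpos.ne').and_eventually (hs.and ht)).exists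
    exact ⟨r, hrU, (dist_triangle_right _ _ _).trans (add_le_add hsr htr)⟩
  have hlim : Tendsto (fun r => K * dist s r + K * dist t r) (𝓝 s) (𝓝 (K * dist s t)) := by
    have hcont : Continuous fun r => K * dist s r + K * dist t r := by fun_prop
    simpa only [dist_self, mul_zero, zero_add, dist_comm t s] using hcont.tendsto s
  exact ge_of_tendsto_of_frequently hlim hfreq

theorem ae_dist_le_of_eLpNorm_diffQuot_le {f : ℂ → ℂ} {μ : Measure (ℂ × ℂ)} {K : ℝ≥0}
    (hf : eLpNorm (diffQuot f) ∞ μ ≤ K) :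
    ∀ᵐ p ∂μ, dist (f p.1) (f p.2) ≤ K * dist p.1 p.2 := by
  rw [eLpNorm_exponent_top] at hf
  filter_upwards [ae_le_eLpNormEssSup (f := diffQuot f) (μ := μ)] with p hp
  rcases eq_or_ne p.1 p.2 with h | h
  · rw [h, dist_self, dist_self, mul_zero]
  · have hnorm : ‖diffQuot f p‖ ≤ K := enorm_le_coe.1 (hp.trans hf)
    rwa [diffQuot, norm_div, div_le_iff₀ (norm_pos_iff.2 (sub_ne_zero.2 h)), ← dist_eq_norm,
      ← dist_eq_norm] at hnorm

/-- The coordinate function `z`, as a bounded symbol. -/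
def coord (hm : MeasurableSet Ω) (hb : Bornology.IsBounded Ω) : Lp ℂ ∞ (leb Ω) :=
  (memLp_id hm hb).toLp fun z => z

theorem coord_coeFn (hm : MeasurableSet Ω) (hb : Bornology.IsBounded Ω) :
    coord hm hb =ᵐ[leb Ω] fun z => z :=
  (memLp_id hm hb).coeFn_toLp

theorem lipschitzOnWith_coord (hm : MeasurableSet Ω) (hb : Bornology.IsBounded Ω) :
    LipschitzOnWith 1 (coord hm hb) {z | coord hm hb z = z} :=
  .of_dist_le_mul fun z hz w hw => by rw [hz, hw, NNReal.coe_one, one_mul]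

theorem ae_norm_diffQuot_coord_le (hm : MeasurableSet Ω) (hb : Bornology.IsBounded Ω) :
    ∀ᵐ p ∂((leb Ω).prod (leb Ω)), ‖diffQuot (coord hm hb) p‖ ≤ 1 := by
  filter_upwards [Measure.quasiMeasurePreserving_fst.ae (coord_coeFn hm hb),
    Measure.quasiMeasurePreserving_snd.ae (coord_coeFn hm hb)] with p hfst hsnd
  rw [diffQuot, hfst, hsnd, norm_div]
  exact div_self_le_one _

theorem coord_mem_Lam (hm : MeasurableSet Ω) (hb : Bornology.IsBounded Ω) :
    coord hm hb ∈ Lam Ω := by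
  have hcoord : Measurable (coord hm hb) := (Lp.stronglyMeasurable _).measurable
  have hmeas : Measurable (diffQuot (coord hm hb)) := by
    unfold diffQuot
    fun_prop
  exact memLp_top_of_bound hmeas.aestronglyMeasurable 1 (ae_norm_diffQuot_coord_le hm hb)

theorem lipNorm_eq (hm : MeasurableSet Ω) (hb : Bornology.IsBounded Ω) {T : Op Ω}
    (hT : IsCompactOperator T) : lipNorm T = hsNorm (comm (opZ hm hb) T) := by
  have hcoord : eLpNorm (diffQuot (coord hm hb)) ∞ ((leb Ω).prod (leb Ω)) ≤ 1 := by
    simpa using eLpNorm_le_of_ae_bound (p := ∞) (ae_norm_diffQuot_coord_le hm hb)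
  refine le_antisymm (iSup₂_le fun f hf => ?_)
    (le_iSup₂ (f := fun (g : Lp ℂ ∞ (leb Ω)) _ => hsNorm (comm (mulOp g) T)) _
      ⟨coord_mem_Lam hm hb, hcoord⟩)
  obtain ⟨G, hG, hlip⟩ :=
    exists_lipschitzOnWith_of_ae_prod (ae_dist_le_of_eLpNorm_diffQuot_le (K := 1) hf.2)
  have hG' : ∀ᵐ x ∂(leb Ω), x ∈ G ∩ {z | coord hm hb z = z} := hG.and (coord_coeFn hm hb)
  choose z hz using fun n (k : CellIdx Ω n) => exists_mem_cell_inter k hG'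
  refine DiagonalApproximation.hsNorm_lie_le
    (diagonalApproximation_mulOp hm hb hG' (hlip.mono Set.inter_subset_left) hz)
    (diagonalApproximation_mulOp hm hb hG'
      ((lipschitzOnWith_coord hm hb).mono Set.inter_subset_right) hz)
    (isExhausting_cellVec hm hb) (fun n j _ k _ => ?_) hT
  rw [(hz n j).2.2, (hz n k).2.2]
  simpa only [dist_eq_norm, NNReal.coe_one, one_mul] using
    hlip.dist_le_mul _ (hz n j).2.1 _ (hz n k).2.1

theorem trace_comm_opZ_eq_zero (hm : MeasurableSet Ω) (hb : Bornology.IsBounded Ω) {X : Op Ω}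
    (hX : IsHilbertSchmidt X) (hZX : IsTraceClass (comm (opZ hm hb) X)) :
    trace (comm (opZ hm hb) X) = 0 := by
  choose z hz using fun n (k : CellIdx Ω n) => exists_mem_cell_inter k (coord_coeFn hm hb)
  exact DiagonalApproximation.trace_lie_eq_zero
    (diagonalApproximation_mulOp hm hb (coord_coeFn hm hb) (lipschitzOnWith_coord hm hb) hz)
    (isExhausting_cellVec hm hb) hX hZX

end Grid

/-! ### Duality for Hilbert--Schmidt and for compact operators -/

section Duality

variable {H : Type*} [NormedAddCommGroup H] [InnerProductSpace ℂ H] [CompleteSpace H]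

theorem enorm_apply_le_hsNorm_mul (T : H →L[ℂ] H) (x : H) : ‖T x‖ₑ ≤ hsNorm T * ‖x‖ₑ := by
  obtain rfl | hx := eq_or_ne x 0
  · rw [map_zero, enorm_zero]
    exact zero_le
  have hrank : ‖T x‖ₑ * ‖x‖ₑ ≤ hsNorm T * ‖x‖ₑ * ‖x‖ₑ := by
    have h := hsNorm_mul_le' T (rankOne ℂ x x)
    rwa [mul_rankOne, hsNorm_rankOne, enorm_rankOne, ← mul_assoc] at h
  exact (ENNReal.mul_le_mul_iff_left (enorm_ne_zero.2 hx) enorm_ne_top).1 hrank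

/-- The trace-class operator `T` as an element of `C₁(H)`. -/
def TraceClass.ofOp (T : H →L[ℂ] H) (hT : IsTraceClass T) : TraceClass H := ⟨T, hT⟩

namespace HilbertSchmidt

/-- The Hilbert--Schmidt operator `T` as an element of `C₂(H)`. -/
def ofOp (T : H →L[ℂ] H) (hT : IsHilbertSchmidt T) : HilbertSchmidt H := ⟨T, hT⟩

theorem toOp_ofOp (T : H →L[ℂ] H) (hT : IsHilbertSchmidt T) : (ofOp T hT).toOp = T := rfl

theorem enorm_eq_hsNorm (K : HilbertSchmidt H) : ‖K‖ₑ = hsNorm K.toOp := by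
  rw [← ofReal_norm, norm_def, ENNReal.ofReal_toReal K.isHilbertSchmidt.ne]

theorem norm_trace_mul_le (K L : HilbertSchmidt H) : ‖trace (K.toOp * L.toOp)‖ ≤ ‖K‖ * ‖L‖ := by
  have h := ENNReal.toReal_mono (ENNReal.mul_lt_top K.isHilbertSchmidt L.isHilbertSchmidt).ne
    ((enorm_trace_le _).trans (traceNorm_mul_le_hsNorm_mul K.toOp L.toOp))
  rwa [ENNReal.toReal_mul, toReal_enorm] at h

theorem norm_toOp_le (K : HilbertSchmidt H) : ‖K.toOp‖ ≤ ‖K‖ := by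
  refine ContinuousLinearMap.opNorm_le_bound _ (norm_nonneg K) fun x => ?_
  have h := enorm_apply_le_hsNorm_mul K.toOp x
  rwa [← K.enorm_eq_hsNorm, ← enorm_norm K, ← enorm_norm x, ← enorm_mul, enorm_le_iff_norm_le,
    Real.norm_of_nonneg (by positivity)] at h

/-- The inclusion `C₂(H) → B(H)` as a bounded operator. -/
def toOpL : HilbertSchmidt H →L[ℂ] (H →L[ℂ] H) :=
  toOp.mkContinuous 1 fun K => (norm_toOp_le K).trans_eq (one_mul ‖K‖).symm

/-- The rank-one operator `x ↦ ⟪b, x⟫ a` as an element of `C₂(H)`, sesquilinear in `(b, a)`. -/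
def ofRankOne : H →ₗ⋆[ℂ] H →ₗ[ℂ] HilbertSchmidt H :=
  LinearMap.mk₂'ₛₗ _ _ (fun b a => ofOp (rankOne ℂ a b) (isHilbertSchmidt_rankOne a b))
    (fun _ _ _ => toOp_injective (by simp only [map_add, toOp_ofOp]))
    (fun _ _ _ => toOp_injective (by simp only [map_smulₛₗ, toOp_ofOp]; rfl))
    (fun _ _ _ => toOp_injective (by simp only [map_add, toOp_ofOp, add_apply]))
    (fun _ _ _ => toOp_injective (by simp only [map_smul, toOp_ofOp, smul_apply]; rfl))

theorem toOp_ofRankOne (b a : H) : (ofRankOne b a).toOp = rankOne ℂ a b := rfl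

theorem norm_ofRankOne (b a : H) : ‖ofRankOne b a‖ = ‖b‖ * ‖a‖ := by
  rw [norm_def, toOp_ofRankOne, hsNorm_rankOne, ENNReal.toReal_mul, toReal_enorm, toReal_enorm,
    mul_comm]

/-- The density of a functional `ψ` on `C₂(H)`, i.e. the operator `y` with `ψ = Tr (· y)`; its
matrix coefficients are the values of `ψ` on rank-one operators. -/
def density (ψ : StrongDual ℂ (HilbertSchmidt H)) : H →L[ℂ] H :=
  ContinuousLinearMap.adjoint <| continuousLinearMapOfBilin <|
    (ofRankOne.compr₂ₛₗ ψ.toLinearMap).mkContinuous₂ ‖ψ‖ fun b a =>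
      (ψ.le_opNorm (ofRankOne b a)).trans_eq (by rw [norm_ofRankOne, mul_assoc])

variable (ψ : StrongDual ℂ (HilbertSchmidt H))

theorem inner_density (b a : H) : ⟪b, density ψ a⟫_ℂ = ψ (ofRankOne b a) := by
  rw [density, ContinuousLinearMap.adjoint_inner_right, continuousLinearMapOfBilin_apply]
  rfl

section Truncation

variable {ι : Type*} (s : Finset ι) (u : ι → H) (T : H →L[ℂ] H)

/-- The finite-rank truncation `P T` as an element of `C₂(H)`, for `P = frameProj s u`. -/
def truncation : HilbertSchmidt H :=
  ofOp (frameProj s u * T) ((isHilbertSchmidt_frameProj s u).mul_right T)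

theorem apply_truncation :
    ψ (truncation s u T) = trace (frameProj s u * (T * density ψ)) := by
  have hsum : truncation s u T = ∑ i ∈ s, ofRankOne (star T (u i)) (u i) :=
    toOp_injective (by rw [map_sum]; exact frameProj_mul s u T)
  rw [hsum, map_sum, trace_frameProj_mul]
  refine Finset.sum_congr rfl fun i _ => ?_
  rw [← inner_density, ContinuousLinearMap.star_eq_adjoint, ContinuousLinearMap.adjoint_inner_left,
    mul_apply_eq_comp]

end Truncation

theorem hsNorm_density_le : hsNorm (density ψ) ≤ ‖ψ‖ₑ := by
  refine hsNorm_le_of_tendsto (K := fun s => density ψ * frameProj s (basis H))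
    (fun x => ((density ψ).continuous.tendsto x).comp (isExhausting_basis.tendsto x)) (fun s => ?_)
    tendsto_const_nhds
  set q := hsNorm (density ψ * frameProj s (basis H)) with hq
  have hq_top : q ≠ ∞ := ((isHilbertSchmidt_frameProj s (basis H)).mul_left (density ψ)).ne
  have hvalue : ‖ψ (truncation s (basis H) (star (density ψ)))‖ₑ = q ^ 2 := by
    have hterm (i) : ⟪basis H i, (star (density ψ) * density ψ) (basis H i)⟫_ℂ =
        ((‖density ψ (basis H i)‖ ^ 2 : ℝ) : ℂ) := by
      rw [mul_apply_eq_comp, ContinuousLinearMap.star_eq_adjoint,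
        ContinuousLinearMap.adjoint_inner_right, inner_self_eq_norm_sq_to_K]
      push_cast
      rfl
    rw [apply_truncation, trace_frameProj_mul, hq,
      hsNorm_mul_frameProj_sq (basis H).orthonormal]
    simp only [hterm]
    rw [← Complex.ofReal_sum, ← ofReal_norm, Complex.norm_of_nonneg (by positivity),
      ENNReal.ofReal_sum_of_nonneg fun i _ => by positivity]
    simp only [ENNReal.ofReal_pow (norm_nonneg _), ofReal_norm]
  have hnorm : ‖truncation s (basis H) (star (density ψ))‖ₑ = q := by
    rw [enorm_eq_hsNorm, truncation, toOp_ofOp, ← hsNorm_star, star_mul, star_star, star_frameProj]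
  have hle : q * q ≤ ‖ψ‖ₑ * q := by
    rw [← sq, ← hvalue, ← hnorm]
    exact ψ.le_opENorm _
  obtain hq0 | hq0 := eq_or_ne q 0
  · exact hq0.trans_le zero_le
  · exact (ENNReal.mul_le_mul_iff_left hq0 hq_top).1 hle

theorem isHilbertSchmidt_density : IsHilbertSchmidt (density ψ) :=
  (hsNorm_density_le ψ).trans_lt enorm_lt_top

theorem apply_eq_trace_mul_density (K : HilbertSchmidt H) :
    ψ K = trace (K.toOp * density ψ) := by
  have htrunc : Tendsto (fun s => truncation s (basis H) K.toOp) atTop (𝓝 K) := by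
    rw [tendsto_iff_edist_tendsto_0]
    simpa only [edist_comm _ K, edist_eq_enorm_sub, enorm_eq_hsNorm, map_sub, truncation,
      toOp_ofOp] using isExhausting_basis.tendsto_hsNorm_sub_mul K.isHilbertSchmidt
  have hψ := (ψ.continuous.tendsto K).comp htrunc
  simp only [Function.comp_def, apply_truncation] at hψ
  exact tendsto_nhds_unique hψ (isExhausting_basis.tendsto_trace_mul
    (K.isHilbertSchmidt.isTraceClass_mul (isHilbertSchmidt_density ψ)))

end HilbertSchmidt

open HilbertSchmidt

theorem exists_hilbertSchmidt_trace_mul_eq (ψ : StrongDual ℂ (HilbertSchmidt H)) :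
    ∃ y : HilbertSchmidt H, ‖y‖ ≤ ‖ψ‖ ∧ ∀ K : HilbertSchmidt H, ψ K = trace (K.toOp * y.toOp) := by
  refine ⟨ofOp (density ψ) (isHilbertSchmidt_density ψ), ?_, apply_eq_trace_mul_density ψ⟩
  rw [← enorm_le_iff_norm_le, enorm_eq_hsNorm]
  exact hsNorm_density_le ψ

theorem traceNorm_density_comp_toOpL_le (ψ : StrongDual ℂ (H →L[ℂ] H)) :
    traceNorm (density (ψ ∘L toOpL)) ≤ ‖ψ‖ₑ := by
  refine traceNorm_le_of_forall_enorm_sum_inner_le fun V hV s => ?_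
  have hP : ‖frameProj s (basis H) * V‖ ≤ 1 :=
    (norm_mul_le _ _).trans
      (mul_le_one₀ (norm_frameProj_le (basis H).orthonormal s) (norm_nonneg V) hV)
  have hvalue : ψ (frameProj s (basis H) * V) =
      ∑ i ∈ s, ⟪basis H i, V (density (ψ ∘L toOpL) (basis H i))⟫_ℂ :=
    (apply_truncation (ψ ∘L toOpL) s (basis H) V).trans (trace_frameProj_mul s (basis H) _)
  rw [← hvalue, enorm_le_iff_norm_le]
  exact (ψ.le_of_opNorm_le_of_le le_rfl hP).trans_eq (mul_one ‖ψ‖)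

theorem exists_traceClass_trace_mul_eq (ψ : StrongDual ℂ (H →L[ℂ] H)) :
    ∃ x : TraceClass H, ‖x‖ ≤ ‖ψ‖ ∧
      ∀ T : H →L[ℂ] H, IsCompactOperator T → ψ T = trace (T * x.toOp) := by
  have hle := traceNorm_density_comp_toOpL_le ψ
  have hx : IsTraceClass (density (ψ ∘L toOpL)) := hle.trans_lt enorm_lt_top
  refine ⟨TraceClass.ofOp _ hx, ?_, fun T hT => ?_⟩
  · rw [TraceClass.norm_def, ← toReal_enorm ψ]
    exact ENNReal.toReal_mono enorm_ne_top hle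
  · have hψ := (ψ.continuous.tendsto T).comp
      (isExhausting_basis.tendsto_mul_of_isCompactOperator hT)
    have htrace := isExhausting_basis.tendsto_trace_mul (hx.mul_left T)
    refine tendsto_nhds_unique hψ (htrace.congr fun s => ?_)
    exact (apply_truncation (ψ ∘L toOpL) s (basis H) T).symm

end Duality

/-! ### Functionals on subspaces, sums and quotients -/

section NormedSpace

variable {𝕜 E F : Type*} [RCLike 𝕜] [NormedAddCommGroup E] [NormedSpace 𝕜 E]
  [NormedAddCommGroup F] [NormedSpace 𝕜 F]

theorem exists_dual_extension (j : E →ₗᵢ[𝕜] F) (φ : StrongDual 𝕜 E) :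
    ∃ ψ : StrongDual 𝕜 F, (∀ x, ψ (j x) = φ x) ∧ ‖ψ‖ ≤ ‖φ‖ := by
  obtain ⟨ψ, hext, hnorm⟩ := exists_extension_norm_eq (LinearMap.range j.toLinearMap)
    (φ ∘L (j.equivRange.symm : LinearMap.range j.toLinearMap →L[𝕜] E))
  refine ⟨ψ, fun x => ?_, hnorm.trans_le ?_⟩
  · exact (hext (j.equivRange x)).trans (congrArg φ (j.equivRange.symm_apply_apply x))
  · refine ContinuousLinearMap.opNorm_le_bound _ (norm_nonneg φ) fun w => ?_
    exact (φ.le_opNorm _).trans_eq (congrArg (‖φ‖ * ·) (j.equivRange.symm.norm_map w))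

theorem exists_dual_components (ψ : StrongDual 𝕜 (WithLp 1 (E × F))) :
    ∃ (ψ₁ : StrongDual 𝕜 E) (ψ₂ : StrongDual 𝕜 F), ‖ψ₁‖ ≤ ‖ψ‖ ∧ ‖ψ₂‖ ≤ ‖ψ‖ ∧
      ∀ x y, ψ (WithLp.toLp 1 (x, y)) = ψ₁ x + ψ₂ y := by
  let e : E × F →L[𝕜] WithLp 1 (E × F) := (WithLp.prodContinuousLinearEquiv 1 𝕜 E F).symm
  refine ⟨ψ ∘L e ∘L .inl 𝕜 E F, ψ ∘L e ∘L .inr 𝕜 E F, ?_, ?_, fun x y => ?_⟩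
  · refine ContinuousLinearMap.opNorm_le_bound _ (norm_nonneg ψ) fun x => ?_
    refine (ψ.le_opNorm _).trans_eq ?_
    simp [e]
  · refine ContinuousLinearMap.opNorm_le_bound _ (norm_nonneg ψ) fun y => ?_
    refine (ψ.le_opNorm _).trans_eq ?_
    simp [e]
  · simp [e, ← map_add, ← WithLp.toLp_add]

end NormedSpace

section Quotient

variable {R E F : Type*} [Ring R] [SeminormedAddCommGroup E] [Module R E]
  [SeminormedAddCommGroup F] [Module R F]

/-- A contraction `A` that lifts every vector without increasing its norm induces an isometric
isomorphism of the quotient by its kernel onto the target. -/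
def quotientIsometryEquiv (A : E →ₗ[R] F) {N : Submodule R E} (hN : N = LinearMap.ker A)
    (hA : ∀ x, ‖A x‖ ≤ ‖x‖) (hlift : ∀ y, ∃ x, A x = y ∧ ‖x‖ ≤ ‖y‖) : (E ⧸ N) ≃ₗᵢ[R] F where
  toLinearEquiv := (N.quotEquivOfEq _ hN).trans
    (A.quotKerEquivOfSurjective fun y => (hlift y).imp fun _ hx => hx.1)
  norm_map' q := by
    refine le_antisymm (le_of_forall_pos_lt_add fun ε hε => ?_) ?_
    · obtain ⟨x, rfl, hx⟩ := Submodule.Quotient.norm_mk_lt q hε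
      exact (hA x).trans_lt hx
    · obtain ⟨x, rfl⟩ := N.mkQ_surjective q
      obtain ⟨x', hx', hnorm⟩ := hlift (A x)
      have hmk : N.mkQ x = N.mkQ x' := by
        simp only [Submodule.mkQ_apply]
        rw [Submodule.Quotient.eq, hN, LinearMap.mem_ker, map_sub, hx', sub_self]
      rw [hmk]
      exact (Submodule.Quotient.norm_mk_le N x').trans (hnorm.trans_eq (congrArg norm hx'.symm))

theorem quotientIsometryEquiv_mk (A : E →ₗ[R] F) {N : Submodule R E} (hN : N = LinearMap.ker A)
    (hA : ∀ x, ‖A x‖ ≤ ‖x‖) (hlift : ∀ y, ∃ x, A x = y ∧ ‖x‖ ≤ ‖y‖) (x : E) :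
    quotientIsometryEquiv A hN hA hlift (Submodule.Quotient.mk x) = A x := rfl

end Quotient

/-! ### The predual of `KΛ(Ω)` -/

section Predual

variable {Ω : Set ℂ} (hm : MeasurableSet Ω) (hb : Bornology.IsBounded Ω)

namespace KLambda

theorem isHilbertSchmidt_comm (T : KLambda Ω) : IsHilbertSchmidt (comm (opZ hm hb) T.toOp) := by
  rw [IsHilbertSchmidt, ← lipNorm_eq hm hb T.isCompactOperator]
  exact T.lipNorm_lt_top

/-- The map `T ↦ [Z, T]` from `KΛ(Ω)` to `C₂`. -/
def commZ : KLambda Ω →ₗ[ℂ] HilbertSchmidt (L2 Ω) where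
  toFun T := .ofOp (comm (opZ hm hb) T.toOp) (T.isHilbertSchmidt_comm hm hb)
  map_add' S T := HilbertSchmidt.toOp_injective (by
    simp only [map_add, HilbertSchmidt.toOp_ofOp, comm_add])
  map_smul' c T := HilbertSchmidt.toOp_injective (by
    simp only [map_smul, HilbertSchmidt.toOp_ofOp, comm_smul, RingHom.id_apply])

theorem norm_eq (T : KLambda Ω) : ‖T‖ = ‖T.toOp‖ + ‖commZ hm hb T‖ := by
  rw [norm_def, lipNorm_eq hm hb T.isCompactOperator]
  rfl

/-- The isometric embedding `T ↦ (T, [Z, T])` of `KΛ(Ω)` into the `ℓ¹`-sum of `B(L²)` and `C₂`. -/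
def embedding : KLambda Ω →ₗᵢ[ℂ] WithLp 1 (Op Ω × HilbertSchmidt (L2 Ω)) where
  toLinearMap := (WithLp.linearEquiv 1 ℂ _).symm.toLinearMap ∘ₗ toOp.prod (commZ hm hb)
  norm_map' T := (WithLp.prod_norm_eq_of_L1 _).trans (T.norm_eq hm hb).symm

/-- The rank-one operator `x ↦ ⟪b, x⟫ a` as an element of `KΛ(Ω)`. -/
def ofRankOne (a b : L2 Ω) : KLambda Ω :=
  ⟨rankOne ℂ a b, by
    change lipNorm (rankOne ℂ a b) < ∞
    rw [lipNorm_eq hm hb (isCompactOperator_rankOne a b)]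
    exact ((isHilbertSchmidt_rankOne a b).mul_left _).sub
      ((isHilbertSchmidt_rankOne a b).mul_right _), isCompactOperator_rankOne a b⟩

theorem toOp_ofRankOne (a b : L2 Ω) : (ofRankOne hm hb a b).toOp = rankOne ℂ a b := rfl

end KLambda

theorem isTraceClass_pairing (T : KLambda Ω) (x : TraceClass (L2 Ω)) (y : HilbertSchmidt (L2 Ω)) :
    IsTraceClass (T.toOp * x.toOp + comm (opZ hm hb) T.toOp * y.toOp) :=
  (x.isTraceClass.mul_left _).add ((T.isHilbertSchmidt_comm hm hb).isTraceClass_mul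
    y.isHilbertSchmidt)

theorem trace_pairing (T : KLambda Ω) (x : TraceClass (L2 Ω)) (y : HilbertSchmidt (L2 Ω)) :
    trace (T.toOp * x.toOp + comm (opZ hm hb) T.toOp * y.toOp) =
      trace (T.toOp * x.toOp) + trace (comm (opZ hm hb) T.toOp * y.toOp) :=
  (x.isTraceClass.mul_left _).trace_add ((T.isHilbertSchmidt_comm hm hb).isTraceClass_mul
    y.isHilbertSchmidt)

theorem norm_trace_pairing_le (p : TraceClass (L2 Ω) × HilbertSchmidt (L2 Ω)) (T : KLambda Ω) :
    ‖trace (T.toOp * p.1.toOp + comm (opZ hm hb) T.toOp * p.2.toOp)‖ ≤ ‖p‖ * ‖T‖ := by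
  calc ‖trace (T.toOp * p.1.toOp + comm (opZ hm hb) T.toOp * p.2.toOp)‖
      ≤ ‖trace (T.toOp * p.1.toOp)‖ + ‖trace ((T.commZ hm hb).toOp * p.2.toOp)‖ := by
        rw [trace_pairing]
        exact norm_add_le _ _
    _ ≤ ‖T.toOp‖ * ‖p.1‖ + ‖T.commZ hm hb‖ * ‖p.2‖ :=
        add_le_add (p.1.isTraceClass.norm_trace_mul_le _) (HilbertSchmidt.norm_trace_mul_le _ _)
    _ ≤ ‖T.toOp‖ * ‖p‖ + ‖T.commZ hm hb‖ * ‖p‖ := by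
        gcongr
        · exact norm_fst_le p
        · exact norm_snd_le p
    _ = ‖p‖ * ‖T‖ := by
        rw [T.norm_eq hm hb]
        ring

/-- The pairing `(T, (x, y)) ↦ Tr (T x + [Z, T] y)`, as a map from `C₁ × C₂` to the dual of
`KΛ(Ω)`. -/
def pairing : TraceClass (L2 Ω) × HilbertSchmidt (L2 Ω) →L[ℂ] StrongDual ℂ (KLambda Ω) :=
  (LinearMap.mk₂ ℂ (fun (p : TraceClass (L2 Ω) × HilbertSchmidt (L2 Ω)) (T : KLambda Ω) =>
      trace (T.toOp * p.1.toOp + comm (opZ hm hb) T.toOp * p.2.toOp))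
    (fun p q T => by
      rw [← (isTraceClass_pairing hm hb T p.1 p.2).trace_add
        (isTraceClass_pairing hm hb T q.1 q.2)]
      simp only [Prod.fst_add, Prod.snd_add, map_add, mul_add]
      rw [add_add_add_comm])
    (fun c p T => by
      simp only [smul_eq_mul, ← trace_smul, Prod.smul_fst, Prod.smul_snd, map_smul, mul_smul_comm,
        smul_add])
    (fun p S T => by
      rw [← (isTraceClass_pairing hm hb S p.1 p.2).trace_add
        (isTraceClass_pairing hm hb T p.1 p.2)]
      simp only [map_add, comm_add, add_mul]
      rw [add_add_add_comm])
    (fun c p T => by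
      simp only [smul_eq_mul, ← trace_smul, map_smul, comm_smul, smul_mul_assoc,
        smul_add])).mkContinuous₂ 1 fun p T => by
        rw [one_mul]
        exact norm_trace_pairing_le hm hb p T

theorem pairing_apply (p : TraceClass (L2 Ω) × HilbertSchmidt (L2 Ω)) (T : KLambda Ω) :
    pairing hm hb p T = trace (T.toOp * p.1.toOp + comm (opZ hm hb) T.toOp * p.2.toOp) := rfl

theorem norm_pairing_le (p : TraceClass (L2 Ω) × HilbertSchmidt (L2 Ω)) :
    ‖pairing hm hb p‖ ≤ ‖p‖ :=
  ContinuousLinearMap.opNorm_le_bound _ (norm_nonneg p) (norm_trace_pairing_le hm hb p)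

theorem trace_comm_rankOne_mul (Z y : Op Ω) (a b : L2 Ω) :
    trace (comm Z (rankOne ℂ a b) * y) = -⟪b, comm Z y a⟫_ℂ := by
  have hmul : comm Z (rankOne ℂ a b) * y = rankOne ℂ (Z a) b * y - rankOne ℂ a b * (Z * y) := by
    rw [comm, sub_mul, mul_rankOne, mul_assoc]
  have hsum := (hasSum_trace_rankOne_mul (Z a) b y).sub (hasSum_trace_rankOne_mul a b (Z * y))
  simp only [← inner_sub_right, ← sub_apply, ← hmul] at hsum
  rw [trace, hsum.tsum_eq, comm, sub_apply, mul_apply_eq_comp, mul_apply_eq_comp,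
    ← inner_neg_right, neg_sub]

theorem pairing_ofRankOne (p : TraceClass (L2 Ω) × HilbertSchmidt (L2 Ω)) (a b : L2 Ω) :
    pairing hm hb p (.ofRankOne hm hb a b) =
      ⟪b, (p.1.toOp - comm (opZ hm hb) p.2.toOp) a⟫_ℂ := by
  rw [pairing_apply, trace_pairing, KLambda.toOp_ofRankOne, trace_rankOne_mul,
    trace_comm_rankOne_mul, sub_apply, inner_sub_right, sub_eq_add_neg]

theorem annN_eq_ker_pairing : annN hm hb = LinearMap.ker (pairing hm hb).toLinearMap := by
  ext p
  constructor
  · intro hp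
    have hcomm : p.1.toOp = comm (opZ hm hb) p.2.toOp := hp
    refine ContinuousLinearMap.ext fun T => ?_
    have hprod : T.toOp * p.1.toOp + comm (opZ hm hb) T.toOp * p.2.toOp =
        comm (opZ hm hb) (T.toOp * p.2.toOp) := by
      rw [hcomm, comm, comm, comm]
      noncomm_ring
    have htrace := isTraceClass_pairing hm hb T p.1 p.2
    rw [hprod] at htrace
    exact (congrArg trace hprod).trans
      (trace_comm_opZ_eq_zero hm hb (p.2.isHilbertSchmidt.mul_left _) htrace)
  · intro hp
    have hzero (a b : L2 Ω) : ⟪b, (p.1.toOp - comm (opZ hm hb) p.2.toOp) a⟫_ℂ = 0 := by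
      rw [← pairing_ofRankOne, show pairing hm hb p = 0 from hp, zero_apply]
    refine sub_eq_zero.1 (ContinuousLinearMap.ext fun a => ext_inner_left ℂ fun b => ?_)
    rw [hzero, zero_apply, inner_zero_right]

theorem exists_pairing_eq (φ : StrongDual ℂ (KLambda Ω)) :
    ∃ p, pairing hm hb p = φ ∧ ‖p‖ ≤ ‖φ‖ := by
  obtain ⟨ψ, hψ, hnorm⟩ := exists_dual_extension (KLambda.embedding hm hb) φ
  obtain ⟨ψ₁, ψ₂, hψ₁, hψ₂, hsum⟩ := exists_dual_components ψ
  obtain ⟨x, hx, hx_trace⟩ := exists_traceClass_trace_mul_eq ψ₁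
  obtain ⟨y, hy, hy_trace⟩ := exists_hilbertSchmidt_trace_mul_eq ψ₂
  refine ⟨(x, y), ContinuousLinearMap.ext fun T => ?_, ?_⟩
  · calc pairing hm hb (x, y) T
        = trace (T.toOp * x.toOp) + trace ((T.commZ hm hb).toOp * y.toOp) :=
          trace_pairing hm hb T x y
      _ = ψ₁ T.toOp + ψ₂ (T.commZ hm hb) := by
          rw [hx_trace _ T.isCompactOperator, hy_trace]
      _ = ψ (KLambda.embedding hm hb T) := (hsum _ _).symm
      _ = φ T := hψ T
  · exact max_le (hx.trans (hψ₁.trans hnorm)) (hy.trans (hψ₂.trans hnorm))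

end Predual

end ELam

end

theorem mainTheorem6 (Ω : Set ℂ) (hm : MeasurableSet Ω) (hb : Bornology.IsBounded Ω) :
    (∀ (T : ELam.KLambda Ω) (x : ELam.TraceClass (ELam.L2 Ω))
        (y : ELam.HilbertSchmidt (ELam.L2 Ω)),
      ELam.IsTraceClass (T.toOp * x.toOp + ELam.comm (ELam.opZ hm hb) T.toOp * y.toOp)) ∧
    ∃ Φ : ((ELam.TraceClass (ELam.L2 Ω) × ELam.HilbertSchmidt (ELam.L2 Ω)) ⧸ ELam.annN hm hb)
        ≃ₗᵢ[ℂ] StrongDual ℂ (ELam.KLambda Ω),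
      ∀ (T : ELam.KLambda Ω) (x : ELam.TraceClass (ELam.L2 Ω))
        (y : ELam.HilbertSchmidt (ELam.L2 Ω)),
        Φ (Submodule.Quotient.mk (x, y)) T =
          ELam.trace (T.toOp * x.toOp + ELam.comm (ELam.opZ hm hb) T.toOp * y.toOp) := by
  refine ⟨ELam.isTraceClass_pairing hm hb, ELam.quotientIsometryEquiv
    (ELam.pairing hm hb).toLinearMap (ELam.annN_eq_ker_pairing hm hb) (ELam.norm_pairing_le hm hb)
    (ELam.exists_pairing_eq hm hb), fun T x y => ?_⟩
  rw [ELam.quotientIsometryEquiv_mk]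
  exact ELam.pairing_apply hm hb (x, y) T
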